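/- **Setting.** Let $n\ge 1$, $p\ge 0$, and let $\mathcal G$ be a strongly connected directed graph on the agents $\{1,\dots,n\}$. Let $\underline A=(a_{ij})$, $\underline B=(b_{ij})$ be real $n\times n$ matrices such that $a_{ij},b_{ij}>0$ if $j=i$ or $j$ can send information to $i$ (i.e. $j\to i$ is an edge), $a_{ij}=b_{ij}=0$ otherwise, $\sum_j a_{ij}=1$ for all $i$ and $\sum_i b_{ij}=1$ for all $j$. Let $f_1,\dots,f_n:\mathbb R^p\to\mathbb R$ be differentiable and $\alpha,\beta>0$ be such that for all $i$ and all $u,v\in\mathbb R^p$ $$\|\nabla f_i(u)-\nabla f_i(v)\|_2\le\beta\|u-v\|_2,\qquad f_i(u)-f_i(v)\le\nabla f_i(u)^\top(u-v)-\tfrac{\alpha}{2}\|u-v\|_2^2 .$$ For a step-size $\eta>0$ and arbitrary $x_i(0)\in\mathbb R^p$, let $y_i(0)=\nabla f_i(x_i(0))$ and, for $k\ge 0$, $$x_i(k+1)=\sum_{j}a_{ij}x_j(k)-\eta\, y_i(k),\qquad y_i(k+1)=\sum_{j}b_{ij}\big(y_j(k)+\nabla f_j(x_j(k+1))-\nabla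 f_j(x_j(k))\big),$$ and let $\mathbf x(k),\mathbf y(k)\in\mathbb R^{np}$ be the stacked vectors. Put $A=\underline A\otimes I_p$ and $B=\underline B\otimes I_p$. Write $\|\cdot\|_2$ for the Euclidean norm and $|||\cdot|||_2$ for the spectral norm. **Theorem.** (a) There are a unique $\pi_r\in\mathbb R^n$ with $\pi_r^\top\underline A=\pi_r^\top$, $\pi_r^\top\mathbf 1_n=1$, a unique $\pi_c\in\mathbb R^n$ with $\underline B\pi_c=\pi_c$, $\mathbf 1_n^\top\pi_c=1$, and a unique minimizer $\mathbf x^*$ of $F=\frac1n\sum_i f_i$; the limits $A_\infty=\lim_k A^k$ and $B_\infty=\lim_k B^k$ exist; and there are norms $\|\cdot\|_A,\|\cdot\|_B$ on $\mathbb R^{np}$ and $\sigma_A,\sigma_B\in(0,1)$ such that for all $\mathbf a\in\mathbb R^{np}$ $$\|(A-A_\infty)\mathbf a\|_A\le\sigma_A\|\mathbf a\|_A,\qquad \|(B-B_\infty)\mathbf a\|_B\le\sigma_B\|\mathbf a\|_B, \tag{1}$$ and constants $g,h,l,m>0$ with $$\|\cdot\|_2\le g\|\cdot\|_A,\quad \|\cdot\|_2\le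 h\|\cdot\|_B,\quad \|\cdot\|_B\le l\|\cdot\|_2,\quad \|\cdot\|_A\le m\|\cdot\|_2. \tag{2}$$ Fix any norms $\|\cdot\|_A,\|\cdot\|_B$, any $\sigma_A,\sigma_B\in(0,1)$ and any $g,h,l,m>0$ satisfying (1) and (2). Let $$\begin{aligned}a_1&=mg\beta|||I-A_\infty|||_2|||B_\infty|||_2,& a_2&=m\beta|||I-A_\infty|||_2|||B_\infty|||_2,& a_3&=mh|||I-A_\infty|||_2,\\ a_4&=n\beta g\,\pi_r^\top\pi_c,& a_5&=h|||A_\infty|||_2,& a_6&=g\sigma_Bl\beta|||A-I|||_2,\\ a_7&=g\sigma_Bl\beta^2|||B_\infty|||_2,& a_8&=\sigma_Bl\beta^2|||B_\infty|||_2,& a_9&=h\sigma_Bl\beta,\end{aligned}$$ $\lambda=\lambda(\eta)=\max\{|1-\alpha n\eta\,\pi_r^\top\pi_c|,\,|1-\beta n\eta\,\pi_r^\top\pi_c|\}$, and $$J(\eta)=\begin{bmatrix}\sigma_A+a_1\eta&a_2\eta&a_3\eta\\ a_4\eta&\lambda&a_5\eta\\ a_6+a_7\eta&a_8\eta&\sigma_B+a_9\eta\end{bmatrix},\qquad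 \mathbf t(k)=\begin{bmatrix}\|\mathbf x(k)-A_\infty\mathbf x(k)\|_A\\ \|A_\infty\mathbf x(k)-\mathbf 1_n\otimes\mathbf x^*\|_2\\ \|\mathbf y(k)-B_\infty\mathbf y(k)\|_B\end{bmatrix}.$$ For $\eta>0$ the matrix $J(\eta)$ is entrywise nonnegative, and all $a_i$ are positive if $n\ge2$ and $p\ge 1$. (b) If $0<\eta<\dfrac{2}{n\beta\,\pi_r^\top\pi_c}$, then, for every initial point, $\mathbf t(k+1)\le J(\eta)\,\mathbf t(k)$ entrywise for all $k\ge0$. (c) Let $n\ge2$ and $p\ge1$. If $\epsilon_1,\epsilon_2,\epsilon_3>0$ satisfy $\epsilon_1<\dfrac{(1-\sigma_B)\epsilon_3}{a_6}$ and $\epsilon_2>\dfrac{a_4\epsilon_1+a_5\epsilon_3}{\alpha n\,\pi_r^\top\pi_c}$, and if $$0<\eta<\min\left\{\frac{\epsilon_1(1-\sigma_A)}{a_1\epsilon_1+a_2\epsilon_2+a_3\epsilon_3},\ \frac{(1-\sigma_B)\epsilon_3-\epsilon_1a_6}{a_7\epsilon_1+a_8\epsilon_2+a_9\epsilon_3},\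 \frac1{n\beta\,\pi_r^\top\pi_c}\right\},$$ then the spectral radius satisfies $\rho(J(\eta))<1$, and, for every initial point, $\|\mathbf x(k)-\mathbf 1_n\otimes\mathbf x^*\|_2$ tends to $0$ and is $O(\rho(J(\eta))^k)$ as $k\to\infty$. -/

import Mathlib

open Filter Topology
open scoped Kronecker Matrix Gradient

namespace DirOpt

/-- `ℝ^p` with the Euclidean norm. -/
abbrev Vec (p : ℕ) := EuclideanSpace ℝ (Fin p)

/-- `ℝ^{np}`, seen as `n` stacked blocks of length `p`, with the Euclidean norm. -/
abbrev StackedVec (n p : ℕ) := EuclideanSpace ℝ (Fin n × Fin p)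

/-- Real `np × np` matrices, indexed by (agent, coordinate). -/
abbrev BigMatrix (n p : ℕ) := Matrix (Fin n × Fin p) (Fin n × Fin p) ℝ

/-- The vector that stacks the local vectors `v 0, …, v (n-1)`. -/
def stack {n p : ℕ} (v : Fin n → Vec p) : StackedVec n p :=
  WithLp.toLp 2 fun ij => v ij.1 ij.2

/-! ### The communication graph and the weights -/

/-- Every agent can be reached from every other one along directed edges;
`G.Adj j i` means that agent `j` can send information to agent `i`. -/
def StronglyConnected {n : ℕ} (G : Digraph (Fin n)) : Prop :=
  ∀ u v : Fin n, Relation.ReflTransGen G.Adj u v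

/-- In-neighbours of `i`: the agents that can send information to `i`, and `i` itself. -/
def inNbrs {n : ℕ} (G : Digraph (Fin n)) (i : Fin n) : Set (Fin n) :=
  {j | j = i ∨ G.Adj j i}

/-- Out-neighbours of `j`: the agents that `j` can send information to, and `j` itself. -/
def outNbrs {n : ℕ} (G : Digraph (Fin n)) (j : Fin n) : Set (Fin n) :=
  {i | i = j ∨ G.Adj j i}

/-- Row-stochastic weights that are compatible with the graph. -/
structure IsRowWeights {n : ℕ} (G : Digraph (Fin n)) (A : Matrix (Fin n) (Fin n) ℝ) : Prop where
  pos : ∀ i j, j ∈ inNbrs G i → 0 < A i j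
  zero : ∀ i j, j ∉ inNbrs G i → A i j = 0
  row_sum : ∀ i, ∑ j, A i j = 1

/-- Column-stochastic weights that are compatible with the graph. -/
structure IsColWeights {n : ℕ} (G : Digraph (Fin n)) (B : Matrix (Fin n) (Fin n) ℝ) : Prop where
  pos : ∀ i j, i ∈ outNbrs G j → 0 < B i j
  zero : ∀ i j, i ∉ outNbrs G j → B i j = 0
  col_sum : ∀ j, ∑ i, B i j = 1

/-- `π` is the left eigenvector of `A` for the eigenvalue `1`, normalised to have sum `1`. -/
def IsLeftEigvec {n : ℕ} (A : Matrix (Fin n) (Fin n) ℝ) (π : Fin n → ℝ) : Prop :=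
  π ᵥ* A = π ∧ ∑ i, π i = 1

/-- `π` is the right eigenvector of `B` for the eigenvalue `1`, normalised to have sum `1`. -/
def IsRightEigvec {n : ℕ} (B : Matrix (Fin n) (Fin n) ℝ) (π : Fin n → ℝ) : Prop :=
  B *ᵥ π = π ∧ ∑ i, π i = 1

/-- The Kronecker product `A ⊗ I_p`. -/
def kronI {n : ℕ} (p : ℕ) (A : Matrix (Fin n) (Fin n) ℝ) : BigMatrix n p :=
  A ⊗ₖ (1 : Matrix (Fin p) (Fin p) ℝ)

/-- The infinite power `lim_k X ^ k` of a matrix. -/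
noncomputable def infPow {n p : ℕ} (X : BigMatrix n p) : BigMatrix n p :=
  limUnder atTop fun k : ℕ => X ^ k

/-- The matrix `X` as an operator on Euclidean `ℝ^{np}`. -/
noncomputable def toOp {n p : ℕ} (X : BigMatrix n p) : StackedVec n p →L[ℝ] StackedVec n p :=
  Matrix.toEuclideanCLM (𝕜 := ℝ) X

/-- The spectral norm of a matrix (its operator norm for the Euclidean norm). -/
noncomputable def specNorm {n p : ℕ} (X : BigMatrix n p) : ℝ := ‖toOp X‖

/-! ### The optimization problem and the algorithm -/

/-- The global objective, the average of the local functions. -/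
noncomputable def objective {n p : ℕ} (f : Fin n → Vec p → ℝ) (z : Vec p) : ℝ :=
  (1 / (n : ℝ)) * ∑ i, f i z

/-- `z` is a global minimizer of the average of the local functions. -/
def IsOptimal {n p : ℕ} (f : Fin n → Vec p → ℝ) (z : Vec p) : Prop :=
  ∀ w, objective f z ≤ objective f w

/-- Every local function is differentiable, with a `β`-Lipschitz gradient, and is
`α`-strongly convex. -/
structure IsAdmissible {n p : ℕ} (f : Fin n → Vec p → ℝ) (α β : ℝ) : Prop where
  alpha_pos : 0 < α
  beta_pos : 0 < β
  differentiable : ∀ i, Differentiable ℝ (f i)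
  lipschitz : ∀ i z w, ‖∇ (f i) z - ∇ (f i) w‖ ≤ β * ‖z - w‖
  strongly_convex : ∀ i z w,
    f i z - f i w ≤ inner ℝ (∇ (f i) z) (z - w) - α / 2 * ‖z - w‖ ^ 2

/-- The pair `(x_i(k), y_i(k))_i` of local variables after `k` iterations with step-size `η`,
started at `x_i(0) = x₀ i` and `y_i(0) = ∇ f_i (x_i(0))`. -/
noncomputable def iter {n p : ℕ} (A B : Matrix (Fin n) (Fin n) ℝ) (f : Fin n → Vec p → ℝ)
    (η : ℝ) (x₀ : Fin n → Vec p) : ℕ → (Fin n → Vec p) × (Fin n → Vec p)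
  | 0 => (x₀, fun i => ∇ (f i) (x₀ i))
  | k + 1 =>
    let x := (iter A B f η x₀ k).1
    let y := (iter A B f η x₀ k).2
    let x' : Fin n → Vec p := fun i => (∑ j, A i j • x j) - η • y i
    (x', fun i => ∑ j, B i j • (y j + ∇ (f j) (x' j) - ∇ (f j) (x j)))

/-- The stacked vector `x(k)`. -/
noncomputable def xIter {n p : ℕ} (A B : Matrix (Fin n) (Fin n) ℝ) (f : Fin n → Vec p → ℝ)
    (η : ℝ) (x₀ : Fin n → Vec p) (k : ℕ) : StackedVec n p :=
  stack (iter A B f η x₀ k).1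

/-- The stacked vector `y(k)`. -/
noncomputable def yIter {n p : ℕ} (A B : Matrix (Fin n) (Fin n) ℝ) (f : Fin n → Vec p → ℝ)
    (η : ℝ) (x₀ : Fin n → Vec p) (k : ℕ) : StackedVec n p :=
  stack (iter A B f η x₀ k).2

/-! ### Contraction norms, the error vector and the matrix `J(η)` -/

/-- `N` is a vector norm on `ℝ^{np}` and `σ ∈ (0, 1)` bounds the matrix norm that `N` induces
at `X - X_∞`. Since `X a - X_∞ a = (X - X_∞) (a - X_∞ a)`, it follows that
`N (X a - X_∞ a) ≤ σ * N (a - X_∞ a)`. -/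
structure IsContractionNorm {n p : ℕ} (X : BigMatrix n p) (N : Seminorm ℝ (StackedVec n p))
    (σ : ℝ) : Prop where
  definite : ∀ v, N v = 0 → v = 0
  sigma_pos : 0 < σ
  sigma_lt_one : σ < 1
  bound : ∀ v, N (toOp (X - infPow X) v) ≤ σ * N v

/-- Positive constants `g, h, l, m` that compare the norms `NA`, `NB` with the Euclidean norm. -/
structure IsEquivConsts {n p : ℕ} (NA NB : Seminorm ℝ (StackedVec n p)) (g h l m : ℝ) : Prop where
  g_pos : 0 < g
  h_pos : 0 < h
  l_pos : 0 < l
  m_pos : 0 < m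
  le_g : ∀ v, ‖v‖ ≤ g * NA v
  le_h : ∀ v, ‖v‖ ≤ h * NB v
  le_l : ∀ v, NB v ≤ l * ‖v‖
  le_m : ∀ v, NA v ≤ m * ‖v‖

/-- The error vector `(‖x - A_∞ x‖_A, ‖A_∞ x - 1 ⊗ x*‖₂, ‖y - B_∞ y‖_B)`, where the arguments
`Ainf`, `Binf` are the infinite powers and `z` is `x*`. -/
noncomputable def errorVec {n p : ℕ} (Ainf Binf : BigMatrix n p)
    (NA NB : Seminorm ℝ (StackedVec n p)) (z : Vec p) (x y : StackedVec n p) : Fin 3 → ℝ :=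
  ![NA (x - toOp Ainf x), ‖toOp Ainf x - stack (fun _ => z)‖, NB (y - toOp Binf y)]

/-- The matrix `J(η)`; `lam` is its middle entry, which depends on `η` as well. -/
def errorMatrix (σA σB lam η a₁ a₂ a₃ a₄ a₅ a₆ a₇ a₈ a₉ : ℝ) : Matrix (Fin 3) (Fin 3) ℝ :=
  !![σA + a₁ * η, a₂ * η, a₃ * η;
     a₄ * η, lam, a₅ * η;
     a₆ + a₇ * η, a₈ * η, σB + a₉ * η]

/-- The spectral radius of a real matrix: the largest modulus of a complex eigenvalue. -/
noncomputable def specRadius (J : Matrix (Fin 3) (Fin 3) ℝ) : ENNReal :=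
  spectralRadius ℂ (J.map (fun r : ℝ => (r : ℂ)))

end DirOpt

open DirOpt

/-!
Let `P` and `Q` be the limits of the powers of `A ⊗ I_p` and `B ⊗ I_p`. They exist because a
positive power of a strongly connected stochastic matrix contracts the vectors of sum zero, by
Doeblin's condition; explicitly `P = (1 πrᵀ) ⊗ I_p` and `Q = (πc 1ᵀ) ⊗ I_p`. Hence the powers of
`A ⊗ I_p - P` tend to zero, and summing the rescaled norms of finitely many points of an orbit
gives a norm for which this matrix is a strict contraction.

The initialisation makes `Q y(k) = Q ∇f(x(k))` an invariant: the agents track the sum of all the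
gradients. Therefore `P x(k)` follows an inexact gradient descent for the average of the `f i`, with
step-size `n η πrᵀπc`, whose exact version contracts by `λ` since
`∇f(u) - ∇f(v) - (α + β)/2 (u - v)` has norm at most `(β - α)/2 ‖u - v‖`. The inexactness is bounded
by the consensus error `x - P x` and the tracking error `y - Q y`, which contract up to
perturbations of order `η` and a multiple of the consensus error; this is the linear recursion
`t(k+1) ≤ J(η) t(k)`.

The bounds on the step-size say that `J(η) ε < ε` for the positive vector `ε`, so `ρ(J(η)) < 1`.
As `J(η)` is positive, it has a positive eigenvector for `ρ(J(η))`, and comparing `t(0)` with a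
multiple of it gives the rate `ρ(J(η))^k`.
-/

namespace DirOpt

/-! ### Powers of primitive stochastic matrices -/

section Primitive

variable {ι R : Type*} [Fintype ι] [DecidableEq ι] [Ring R] [LinearOrder R] [IsStrictOrderedRing R]
  {A : Matrix ι ι R}

theorem pow_succ_apply_pos (hA : ∀ i j, 0 ≤ A i j) {k : ℕ} {i l j : ι}
    (hil : 0 < A i l) (hlj : 0 < (A ^ k) l j) : 0 < (A ^ (k + 1)) i j := by
  rw [pow_succ', Matrix.mul_apply]
  exact Finset.sum_pos' (fun l _ => mul_nonneg (hA i l) (Matrix.pow_apply_nonneg hA k l j))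
    ⟨l, Finset.mem_univ l, mul_pos hil hlj⟩

theorem pow_apply_pos_mono (hA : ∀ i j, 0 ≤ A i j) (hdiag : ∀ i, 0 < A i i) {k l : ℕ}
    (hkl : k ≤ l) {i j : ι} (h : 0 < (A ^ k) i j) : 0 < (A ^ l) i j := by
  induction l, hkl using Nat.le_induction with
  | base => exact h
  | succ l _ ih => exact pow_succ_apply_pos hA (hdiag i) ih

theorem isPrimitive_of_diag_pos (hA : ∀ i j, 0 ≤ A i j) (hdiag : ∀ i, 0 < A i i)
    (hconn : ∀ i j, Relation.ReflTransGen (fun i j => 0 < A i j) i j) : A.IsPrimitive := by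
  have hreach : ∀ i j, ∃ k, 0 < (A ^ k) i j := fun i j => by
    induction hconn i j using Relation.ReflTransGen.head_induction_on with
    | refl => exact ⟨0, by simp⟩
    | head hadj _ ih =>
      obtain ⟨k, hk⟩ := ih
      exact ⟨k + 1, pow_succ_apply_pos hA hadj hk⟩
  choose k hk using hreach
  obtain ⟨N, hN⟩ := Finite.exists_le fun ij : ι × ι => k ij.1 ij.2
  exact ⟨hA, N + 1, N.succ_pos, fun i j =>
    pow_apply_pos_mono hA hdiag ((hN (i, j)).trans N.le_succ) (hk i j)⟩

end Primitive

section Stochastic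

variable {ι : Type*} [Fintype ι] [DecidableEq ι] {A : Matrix ι ι ℝ} {π w : ι → ℝ}

theorem sum_vecMul (hA : A ∈ Matrix.rowStochastic ℝ ι) (w : ι → ℝ) :
    ∑ j, (w ᵥ* A) j = ∑ i, w i := by
  rw [← dotProduct_one, ← Matrix.dotProduct_mulVec, hA.2, dotProduct_one]

/-- Doeblin's condition: subtracting `δ` from every entry does not change the action on the
vectors of sum zero, and it lowers every row sum by `card ι * δ`. -/
theorem sum_abs_vecMul_le (hA : A ∈ Matrix.rowStochastic ℝ ι) {δ : ℝ} (hδ : ∀ i j, δ ≤ A i j)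
    (hw : ∑ i, w i = 0) : ∑ j, |(w ᵥ* A) j| ≤ (1 - Fintype.card ι * δ) * ∑ i, |w i| := by
  have hsub : ∀ j, (w ᵥ* A) j = ∑ i, w i * (A i j - δ) := fun j => by
    simp only [Matrix.vecMul, dotProduct, mul_sub, Finset.sum_sub_distrib, ← Finset.sum_mul, hw,
      zero_mul, sub_zero]
  have hrow : ∀ i, ∑ j, (A i j - δ) = 1 - Fintype.card ι * δ := fun i => by
    rw [Finset.sum_sub_distrib, Matrix.sum_row_of_mem_rowStochastic hA, Finset.sum_const,
      nsmul_eq_mul, Finset.card_univ]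
  calc ∑ j, |(w ᵥ* A) j| ≤ ∑ j, ∑ i, |w i| * (A i j - δ) := by
        refine Finset.sum_le_sum fun j _ => ?_
        rw [hsub]
        refine (Finset.abs_sum_le_sum_abs _ _).trans_eq (Finset.sum_congr rfl fun i _ => ?_)
        rw [abs_mul, abs_of_nonneg (sub_nonneg.2 (hδ i j))]
    _ = (1 - Fintype.card ι * δ) * ∑ i, |w i| := by
        rw [Finset.sum_comm, Finset.mul_sum]
        exact Finset.sum_congr rfl fun i _ => by rw [← Finset.mul_sum, hrow, mul_comm]

theorem exists_sum_abs_vecMul_le_of_pos [Nonempty ι] (hA : A ∈ Matrix.rowStochastic ℝ ι)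
    (hpos : ∀ i j, 0 < A i j) : ∃ q : ℝ, 0 ≤ q ∧ q < 1 ∧
      ∀ w : ι → ℝ, ∑ i, w i = 0 → ∑ j, |(w ᵥ* A) j| ≤ q * ∑ i, |w i| := by
  obtain ⟨⟨r, c⟩, hmin⟩ := Finite.exists_min fun ij : ι × ι => A ij.1 ij.2
  have hδ : ∀ i j, A r c ≤ A i j := fun i j => hmin (i, j)
  refine ⟨1 - Fintype.card ι * A r c, ?_, ?_, fun w hw => sum_abs_vecMul_le hA hδ hw⟩
  · rw [sub_nonneg, ← Matrix.sum_row_of_mem_rowStochastic hA r, ← nsmul_eq_mul]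
    exact Finset.card_nsmul_le_sum _ _ _ fun j _ => hδ r j
  · exact sub_lt_self _ (mul_pos (by exact_mod_cast Fintype.card_pos) (hpos r c))

theorem tendsto_vecMul_pow (hA : A ∈ Matrix.rowStochastic ℝ ι) (hprim : A.IsPrimitive)
    (hw : ∑ i, w i = 0) : Tendsto (fun k : ℕ => w ᵥ* A ^ k) atTop (𝓝 0) := by
  cases isEmpty_or_nonempty ι
  · simp only [Subsingleton.elim _ (0 : ι → ℝ), tendsto_const_nhds]
  obtain ⟨N, hN, hpos⟩ := hprim.exists_pos_pow
  obtain ⟨q, hq0, hq1, hq⟩ := exists_sum_abs_vecMul_le_of_pos (pow_mem hA N) hpos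
  set s : ℕ → ℝ := fun k => ∑ j, |(w ᵥ* A ^ k) j|
  have hsum : ∀ k, ∑ j, (w ᵥ* A ^ k) j = 0 := fun k => by rw [sum_vecMul (pow_mem hA k), hw]
  have hanti : Antitone s := antitone_nat_of_succ_le fun k => by
    simpa only [Matrix.vecMul_vecMul, ← pow_succ, mul_zero, sub_zero, one_mul] using
      sum_abs_vecMul_le hA hprim.nonneg (hsum k)
  have hgeom : ∀ k, s (N * k) ≤ q ^ k * s 0 := fun k =>
    le_geom (u := fun k => s (N * k)) hq0 k fun k _ => by
      simpa only [Matrix.vecMul_vecMul, ← pow_add, ← mul_add_one] using hq _ (hsum (N * k))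
  have hsubseq : Tendsto (s ∘ (N * ·)) atTop (𝓝 0) := by
    refine squeeze_zero (fun k => Finset.sum_nonneg fun j _ => abs_nonneg _) hgeom ?_
    simpa only [zero_mul] using (tendsto_pow_atTop_nhds_zero_of_lt_one hq0 hq1).mul_const (s 0)
  have hlim : Tendsto s atTop (𝓝 0) :=
    (tendsto_iff_tendsto_subseq_of_antitone hanti (tendsto_id.const_mul_atTop' hN)).2 hsubseq
  exact tendsto_pi_nhds.2 fun j => squeeze_zero_norm
    (fun k => Finset.single_le_sum (f := fun j => |(w ᵥ* A ^ k) j|) (fun _ _ => abs_nonneg _)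
      (Finset.mem_univ j)) hlim

theorem vecMul_pow_of_fixed (hπ : π ᵥ* A = π) (k : ℕ) : π ᵥ* A ^ k = π := by
  induction k with
  | zero => simp
  | succ k ih => rw [pow_succ, ← Matrix.vecMul_vecMul, ih, hπ]

theorem eq_zero_of_vecMul_eq_self (hA : A ∈ Matrix.rowStochastic ℝ ι) (hprim : A.IsPrimitive)
    (hw : ∑ i, w i = 0) (hfix : w ᵥ* A = w) : w = 0 := by
  have hlim := tendsto_vecMul_pow hA hprim hw
  simp only [vecMul_pow_of_fixed hfix] at hlim
  exact tendsto_nhds_unique tendsto_const_nhds hlim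

theorem exists_vecMul_eq_self [Nonempty ι] (hA : A ∈ Matrix.rowStochastic ℝ ι) :
    ∃ v ≠ 0, v ᵥ* A = v := by
  have hone : (A - 1) *ᵥ 1 = 0 := by rw [Matrix.sub_mulVec, hA.2, Matrix.one_mulVec, sub_self]
  have hdet : (A - 1).det = 0 := Matrix.exists_mulVec_eq_zero_iff.1 ⟨1, one_ne_zero, hone⟩
  obtain ⟨v, hv0, hv⟩ := Matrix.exists_vecMul_eq_zero_iff.2 hdet
  exact ⟨v, hv0, by rwa [Matrix.vecMul_sub, Matrix.vecMul_one, sub_eq_zero] at hv⟩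

theorem existsUnique_vecMul_eq_self [Nonempty ι] (hA : A ∈ Matrix.rowStochastic ℝ ι)
    (hprim : A.IsPrimitive) : ∃! π, π ᵥ* A = π ∧ ∑ i, π i = 1 := by
  obtain ⟨v, hv0, hv⟩ := exists_vecMul_eq_self hA
  have hsum : ∑ i, v i ≠ 0 := fun h => hv0 (eq_zero_of_vecMul_eq_self hA hprim h hv)
  refine existsUnique_of_exists_of_unique ⟨(∑ i, v i)⁻¹ • v, ?_, ?_⟩ ?_
  · rw [Matrix.smul_vecMul, hv]
  · simp [← Finset.mul_sum, hsum]
  · rintro w w' ⟨hw, hw1⟩ ⟨hw', hw'1⟩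
    refine sub_eq_zero.1 (eq_zero_of_vecMul_eq_self hA hprim ?_ ?_)
    · simp [hw1, hw'1]
    · rw [Matrix.sub_vecMul, hw, hw']

theorem tendsto_pow_replicateRow (hA : A ∈ Matrix.rowStochastic ℝ ι) (hprim : A.IsPrimitive)
    (hπ : π ᵥ* A = π) (hsum : ∑ i, π i = 1) :
    Tendsto (fun k : ℕ => A ^ k) atTop (𝓝 (Matrix.replicateRow ι π)) := by
  refine tendsto_pi_nhds.2 fun i => ?_
  have hlim := (tendsto_vecMul_pow hA hprim (w := Pi.single i 1 - π) (by simp [hsum])).add_const π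
  simp only [Matrix.sub_vecMul, vecMul_pow_of_fixed hπ, sub_add_cancel, zero_add,
    Matrix.single_one_vecMul] at hlim
  exact hlim

theorem pos_of_vecMul_eq_self (hA : A ∈ Matrix.rowStochastic ℝ ι) (hprim : A.IsPrimitive)
    (hπ : π ᵥ* A = π) (hsum : ∑ i, π i = 1) (i : ι) : 0 < π i := by
  have hnonneg : ∀ j, 0 ≤ π j := fun j => ge_of_tendsto'
    (tendsto_pi_nhds.1 (tendsto_pi_nhds.1 (tendsto_pow_replicateRow hA hprim hπ hsum) i) j)
    fun k => Matrix.pow_apply_nonneg hprim.nonneg k i j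
  obtain ⟨j, -, hj⟩ : ∃ j ∈ Finset.univ, 0 < π j :=
    Finset.exists_lt_of_sum_lt (by simp [hsum])
  obtain ⟨N, -, hpos⟩ := hprim.exists_pos_pow
  rw [← vecMul_pow_of_fixed hπ N]
  exact Finset.sum_pos' (fun l _ => mul_nonneg (hnonneg l) (hpos l i).le)
    ⟨j, Finset.mem_univ j, mul_pos hj (hpos j i)⟩

end Stochastic

/-! ### The weights of a strongly connected graph -/

section Weights

variable {n : ℕ} {G : Digraph (Fin n)} {A B : Matrix (Fin n) (Fin n) ℝ} {π : Fin n → ℝ}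

namespace IsRowWeights

theorem nonneg (hA : IsRowWeights G A) (i j : Fin n) : 0 ≤ A i j := by
  by_cases h : j ∈ inNbrs G i
  · exact (hA.pos i j h).le
  · exact (hA.zero i j h).ge

theorem mem_rowStochastic (hA : IsRowWeights G A) : A ∈ Matrix.rowStochastic ℝ (Fin n) :=
  Matrix.mem_rowStochastic_iff_sum.2 ⟨hA.nonneg, hA.row_sum⟩

theorem isPrimitive (hA : IsRowWeights G A) (hG : StronglyConnected G) : A.IsPrimitive :=
  isPrimitive_of_diag_pos hA.nonneg (fun i => hA.pos i i (Or.inl rfl)) fun i j =>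
    Relation.ReflTransGen.mono (fun _ _ h => hA.pos _ _ (Or.inr h)) _ _ (hG j i).swap

theorem existsUnique_isLeftEigvec [NeZero n] (hA : IsRowWeights G A) (hG : StronglyConnected G) :
    ∃! π, IsLeftEigvec A π :=
  existsUnique_vecMul_eq_self hA.mem_rowStochastic (hA.isPrimitive hG)

theorem tendsto_pow (hA : IsRowWeights G A) (hG : StronglyConnected G) (hπ : IsLeftEigvec A π) :
    Tendsto (fun k : ℕ => A ^ k) atTop (𝓝 (Matrix.replicateRow (Fin n) π)) :=
  tendsto_pow_replicateRow hA.mem_rowStochastic (hA.isPrimitive hG) hπ.1 hπ.2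

theorem leftEigvec_pos (hA : IsRowWeights G A) (hG : StronglyConnected G)
    (hπ : IsLeftEigvec A π) (i : Fin n) : 0 < π i :=
  pos_of_vecMul_eq_self hA.mem_rowStochastic (hA.isPrimitive hG) hπ.1 hπ.2 i

end IsRowWeights

/-- The digraph with all edges reversed; it turns column weights into row weights. -/
def reversed (G : Digraph (Fin n)) : Digraph (Fin n) := ⟨fun u v => G.Adj v u⟩

theorem StronglyConnected.reversed (hG : StronglyConnected G) :
    StronglyConnected (reversed G) := fun u v => (hG v u).swap

theorem isRightEigvec_iff_transpose : IsRightEigvec B π ↔ IsLeftEigvec Bᵀ π := by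
  rw [IsRightEigvec, IsLeftEigvec, Matrix.vecMul_transpose]

namespace IsColWeights

theorem transpose (hB : IsColWeights G B) : IsRowWeights (reversed G) Bᵀ :=
  ⟨fun i j => hB.pos j i, fun i j => hB.zero j i, hB.col_sum⟩

theorem existsUnique_isRightEigvec [NeZero n] (hB : IsColWeights G B)
    (hG : StronglyConnected G) : ∃! π, IsRightEigvec B π := by
  simpa only [isRightEigvec_iff_transpose] using
    hB.transpose.existsUnique_isLeftEigvec hG.reversed

theorem tendsto_pow (hB : IsColWeights G B) (hG : StronglyConnected G) (hπ : IsRightEigvec B π) :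
    Tendsto (fun k : ℕ => B ^ k) atTop (𝓝 (Matrix.replicateCol (Fin n) π)) := by
  have hlim := hB.transpose.tendsto_pow hG.reversed (isRightEigvec_iff_transpose.1 hπ)
  simpa only [Function.comp_def, id_eq, Matrix.transpose_pow, Matrix.transpose_transpose,
    Matrix.transpose_replicateRow] using
    ((continuous_id.matrix_transpose (n := Fin n) (R := ℝ)).tendsto _).comp hlim

theorem rightEigvec_pos (hB : IsColWeights G B) (hG : StronglyConnected G)
    (hπ : IsRightEigvec B π) (i : Fin n) : 0 < π i :=
  hB.transpose.leftEigvec_pos hG.reversed (isRightEigvec_iff_transpose.1 hπ) i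

end IsColWeights

end Weights

/-! ### Limits of powers and contraction norms -/

section PowerLimit

variable {R : Type*} [TopologicalSpace R] [T2Space R] {X P : R}

theorem mul_limit_of_tendsto_pow [Monoid R] [ContinuousMul R]
    (h : Tendsto (fun k : ℕ => X ^ k) atTop (𝓝 P)) : X * P = P := by
  refine tendsto_nhds_unique (h.const_mul X) ?_
  simpa only [← pow_succ'] using (tendsto_add_atTop_iff_nat 1).2 h

theorem limit_mul_of_tendsto_pow [Monoid R] [ContinuousMul R]
    (h : Tendsto (fun k : ℕ => X ^ k) atTop (𝓝 P)) : P * X = P := by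
  refine tendsto_nhds_unique (h.mul_const X) ?_
  simpa only [← pow_succ] using (tendsto_add_atTop_iff_nat 1).2 h

theorem limit_mul_pow_of_tendsto_pow [Monoid R] [ContinuousMul R]
    (h : Tendsto (fun k : ℕ => X ^ k) atTop (𝓝 P)) (k : ℕ) : P * X ^ k = P := by
  induction k with
  | zero => simp
  | succ k ih => rw [pow_succ, ← mul_assoc, ih, limit_mul_of_tendsto_pow h]

theorem isIdempotentElem_of_tendsto_pow [Monoid R] [ContinuousMul R]
    (h : Tendsto (fun k : ℕ => X ^ k) atTop (𝓝 P)) : IsIdempotentElem P := by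
  refine tendsto_nhds_unique (h.const_mul P) ?_
  simp only [limit_mul_pow_of_tendsto_pow h, tendsto_const_nhds]

theorem ne_one_of_tendsto_pow [Monoid R] (h : Tendsto (fun k : ℕ => X ^ k) atTop (𝓝 P))
    (hP : P ≠ 1) : X ≠ 1 := by
  rintro rfl
  refine hP (tendsto_nhds_unique h ?_)
  simp only [one_pow, tendsto_const_nhds]

theorem sub_pow_succ_of_tendsto_pow [Ring R] [ContinuousMul R]
    (h : Tendsto (fun k : ℕ => X ^ k) atTop (𝓝 P)) (k : ℕ) :
    (X - P) ^ (k + 1) = X ^ (k + 1) - P := by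
  induction k with
  | zero => simp
  | succ k ih =>
    rw [pow_succ', ih, sub_mul, mul_sub, mul_sub, ← pow_succ', mul_limit_of_tendsto_pow h,
      (isIdempotentElem_of_tendsto_pow h).eq, limit_mul_pow_of_tendsto_pow h, sub_self, sub_zero]

theorem tendsto_sub_pow_of_tendsto_pow [Ring R] [IsTopologicalRing R]
    (h : Tendsto (fun k : ℕ => X ^ k) atTop (𝓝 P)) :
    Tendsto (fun k : ℕ => (X - P) ^ k) atTop (𝓝 0) := by
  rw [← tendsto_add_atTop_iff_nat 1]
  simpa only [sub_pow_succ_of_tendsto_pow h, sub_self] using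
    ((tendsto_add_atTop_iff_nat 1).2 h).sub_const P

end PowerLimit

section Contraction

variable {E : Type*} [NormedAddCommGroup E] [NormedSpace ℝ E] {M : E →L[ℝ] E}

/-- The seminorm `v ↦ ∑_{j < N} c ^ j * ‖M ^ j v‖`. When `‖M ^ N‖ ≤ σ ^ N` and `c = σ⁻¹`, the
operator `M` contracts it by the factor `σ`. -/
noncomputable def orbitSeminorm (M : E →L[ℝ] E) (c : NNReal) (N : ℕ) : Seminorm ℝ E :=
  ∑ j ∈ Finset.range N, c ^ j • (normSeminorm ℝ E).comp (M ^ j).toLinearMap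

theorem orbitSeminorm_apply (M : E →L[ℝ] E) (c : NNReal) (N : ℕ) (v : E) :
    orbitSeminorm M c N v = ∑ j ∈ Finset.range N, (c : ℝ) ^ j * ‖(M ^ j) v‖ := by
  simp [orbitSeminorm, NNReal.smul_def, Module.End.pow_apply]

theorem norm_le_orbitSeminorm (M : E →L[ℝ] E) (c : NNReal) {N : ℕ} (hN : N ≠ 0) (v : E) :
    ‖v‖ ≤ orbitSeminorm M c N v := by
  rw [orbitSeminorm_apply]
  simpa using Finset.single_le_sum (f := fun j => (c : ℝ) ^ j * ‖(M ^ j) v‖)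
    (fun j _ => by positivity) (Finset.mem_range.2 (Nat.pos_of_ne_zero hN))

theorem orbitSeminorm_le (M : E →L[ℝ] E) (c : NNReal) (N : ℕ) (v : E) :
    orbitSeminorm M c N v ≤ (∑ j ∈ Finset.range N, (c : ℝ) ^ j * ‖M ^ j‖) * ‖v‖ := by
  rw [orbitSeminorm_apply, Finset.sum_mul]
  refine Finset.sum_le_sum fun j _ => ?_
  rw [mul_assoc]
  gcongr
  exact (M ^ j).le_opNorm v

theorem orbitSeminorm_map_le {σ : NNReal} (hσ : σ ≠ 0) {N : ℕ} (hM : ‖M ^ N‖ ≤ σ ^ N) (v : E) :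
    orbitSeminorm M σ⁻¹ N (M v) ≤ σ * orbitSeminorm M σ⁻¹ N v := by
  have hσ' : (σ : ℝ) ≠ 0 := NNReal.coe_ne_zero.2 hσ
  set a : ℕ → ℝ := fun j => (σ : ℝ)⁻¹ ^ j * ‖(M ^ j) v‖ with ha
  have hS : orbitSeminorm M σ⁻¹ N v = ∑ j ∈ Finset.range N, a j := by
    rw [orbitSeminorm_apply, NNReal.coe_inv]
  have hSM : orbitSeminorm M σ⁻¹ N (M v) = σ * ∑ j ∈ Finset.range N, a (j + 1) := by
    rw [orbitSeminorm_apply, NNReal.coe_inv, Finset.mul_sum]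
    refine Finset.sum_congr rfl fun j _ => ?_
    simp only [ha, pow_succ, mul_apply_eq_comp]
    field_simp
  have hlast : a N ≤ a 0 := by
    calc a N ≤ (σ : ℝ)⁻¹ ^ N * (σ ^ N * ‖v‖) :=
          mul_le_mul_of_nonneg_left ((M ^ N).le_of_opNorm_le hM v) (by positivity)
      _ = a 0 := by simp [ha, hσ']
  rw [hS, hSM]
  refine mul_le_mul_of_nonneg_left ?_ σ.coe_nonneg
  linarith [Finset.sum_range_succ a N, Finset.sum_range_succ' a N]

theorem exists_seminorm_map_le (hM : Tendsto (fun k : ℕ => M ^ k) atTop (𝓝 0)) :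
    ∃ (S : Seminorm ℝ E) (σ C : ℝ), 0 < σ ∧ σ < 1 ∧ 0 < C ∧ (∀ v, ‖v‖ ≤ S v) ∧
      (∀ v, S v ≤ C * ‖v‖) ∧ ∀ v, S (M v) ≤ σ * S v := by
  obtain ⟨N, hN, hN0⟩ := ((hM.norm.eventually_le_const (u := 1 / 2) (by simp)).and
    (eventually_ne_atTop 0)).exists
  set σ : NNReal := (1 / 2) ^ (N : ℝ)⁻¹ with hσ
  have hσ0 : 0 < σ := NNReal.rpow_pos (by norm_num)
  have hσ1 : σ < 1 := NNReal.rpow_lt_one (by norm_num) (by positivity)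
  have hσN : ‖M ^ N‖ ≤ σ ^ N := by
    rw [← NNReal.coe_pow, hσ, NNReal.rpow_inv_natCast_pow _ hN0]
    simpa using hN
  refine ⟨orbitSeminorm M σ⁻¹ N, σ, (∑ j ∈ Finset.range N, (σ⁻¹ : NNReal) ^ j * ‖M ^ j‖) + 1,
    hσ0, hσ1, by positivity, norm_le_orbitSeminorm M _ hN0, fun v => ?_,
    orbitSeminorm_map_le hσ0.ne' hσN⟩
  exact (orbitSeminorm_le M _ N v).trans (by gcongr; exact le_add_of_nonneg_right zero_le_one)

end Contraction

/-! ### Operators on stacked vectors -/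

section Operators

variable {n p : ℕ} {X P : BigMatrix n p}

theorem toOp_one : toOp (1 : BigMatrix n p) = 1 := map_one _

theorem toOp_mul (X Y : BigMatrix n p) : toOp (X * Y) = toOp X * toOp Y := map_mul _ _ _

theorem toOp_sub (X Y : BigMatrix n p) : toOp (X - Y) = toOp X - toOp Y := map_sub _ _ _

theorem toOp_pow (X : BigMatrix n p) (k : ℕ) : toOp (X ^ k) = toOp X ^ k := map_pow _ _ _

theorem specNorm_zero : specNorm (0 : BigMatrix n p) = 0 :=
  norm_eq_zero.2 (map_zero (Matrix.toEuclideanCLM (𝕜 := ℝ)))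

theorem specNorm_pos (hX : X ≠ 0) : 0 < specNorm X :=
  norm_pos_iff.2 ((map_ne_zero_iff _ (Matrix.toEuclideanCLM (𝕜 := ℝ)).injective).2 hX)

theorem norm_toOp_le (X : BigMatrix n p) (v : StackedVec n p) : ‖toOp X v‖ ≤ specNorm X * ‖v‖ :=
  (toOp X).le_opNorm v

theorem continuous_toOp : Continuous (toOp : BigMatrix n p → _) :=
  (Matrix.toEuclideanCLM (n := Fin n × Fin p) (𝕜 := ℝ)).toAlgEquiv.toLinearMap
    |>.continuous_of_finiteDimensional

theorem tendsto_toOp_sub_pow (h : Tendsto (fun k : ℕ => X ^ k) atTop (𝓝 P)) :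
    Tendsto (fun k : ℕ => toOp (X - P) ^ k) atTop (𝓝 0) := by
  have hzero : toOp (0 : BigMatrix n p) = 0 := map_zero _
  simpa only [Function.comp_def, toOp_pow, hzero] using
    (continuous_toOp.tendsto 0).comp (tendsto_sub_pow_of_tendsto_pow h)

theorem exists_isContractionNorm (h : Tendsto (fun k : ℕ => X ^ k) atTop (𝓝 P)) :
    ∃ (N : Seminorm ℝ (StackedVec n p)) (σ C : ℝ), IsContractionNorm X N σ ∧ 0 < C ∧
      (∀ v, ‖v‖ ≤ N v) ∧ ∀ v, N v ≤ C * ‖v‖ := by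
  obtain ⟨N, σ, C, hσ0, hσ1, hC, hge, hle, hmap⟩ := exists_seminorm_map_le (tendsto_toOp_sub_pow h)
  exact ⟨N, σ, C, ⟨fun v hv => norm_le_zero_iff.1 (hv ▸ hge v), hσ0, hσ1,
    by rwa [infPow, h.limUnder_eq]⟩, hC, hge, hle⟩

theorem kronI_mul (A B : Matrix (Fin n) (Fin n) ℝ) :
    kronI p (A * B) = kronI p A * kronI p B := by
  rw [kronI, kronI, kronI, ← Matrix.mul_kronecker_mul, one_mul]

theorem kronI_one : kronI p (1 : Matrix (Fin n) (Fin n) ℝ) = 1 := Matrix.one_kronecker_one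

theorem kronI_pow (A : Matrix (Fin n) (Fin n) ℝ) (k : ℕ) : kronI p (A ^ k) = kronI p A ^ k := by
  induction k with
  | zero => rw [pow_zero, pow_zero, kronI_one]
  | succ k ih => rw [pow_succ, pow_succ, kronI_mul, ih]

theorem tendsto_kronI_pow {A Ainf : Matrix (Fin n) (Fin n) ℝ}
    (h : Tendsto (fun k : ℕ => A ^ k) atTop (𝓝 Ainf)) :
    Tendsto (fun k : ℕ => kronI p A ^ k) atTop (𝓝 (kronI p Ainf)) := by
  have hcont : Continuous (kronI p : Matrix (Fin n) (Fin n) ℝ → BigMatrix n p) :=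
    continuous_matrix fun i j => (continuous_id.matrix_elem i.1 j.1).mul continuous_const
  simpa only [Function.comp_def, kronI_pow] using (hcont.tendsto Ainf).comp h

theorem kronI_injective (hp : p ≠ 0) :
    Function.Injective (kronI p : Matrix (Fin n) (Fin n) ℝ → BigMatrix n p) := by
  intro A B h
  ext i j
  simpa [kronI] using congrFun₂ h (i, ⟨0, Nat.pos_of_ne_zero hp⟩) (j, ⟨0, Nat.pos_of_ne_zero hp⟩)

theorem toOp_kronI_stack (A : Matrix (Fin n) (Fin n) ℝ) (v : Fin n → Vec p) :
    toOp (kronI p A) (stack v) = stack fun i => ∑ j, A i j • v j := by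
  ext ⟨i, c⟩
  rw [toOp, stack, Matrix.toEuclideanCLM_toLp, stack]
  simp [Matrix.mulVec, dotProduct, kronI, Fintype.sum_prod_type, Matrix.one_apply]

theorem norm_stack_sq (v : Fin n → Vec p) : ‖stack v‖ ^ 2 = ∑ i, ‖v i‖ ^ 2 := by
  simp [EuclideanSpace.norm_sq_eq, stack, Fintype.sum_prod_type]

theorem norm_stack_le {v w : Fin n → Vec p} {c : ℝ} (hc : 0 ≤ c)
    (h : ∀ i, ‖v i‖ ≤ c * ‖w i‖) : ‖stack v‖ ≤ c * ‖stack w‖ := by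
  refine le_of_sq_le_sq ?_ (by positivity)
  rw [mul_pow, norm_stack_sq, norm_stack_sq, Finset.mul_sum]
  refine Finset.sum_le_sum fun i _ => ?_
  rw [← mul_pow]
  exact pow_le_pow_left₀ (norm_nonneg _) (h i) 2

theorem norm_stack_const (u : Vec p) : ‖stack (n := n) fun _ => u‖ = √n * ‖u‖ := by
  refine (sq_eq_sq₀ (norm_nonneg _) (by positivity)).1 ?_
  rw [norm_stack_sq, mul_pow, Real.sq_sqrt n.cast_nonneg]
  simp

theorem sum_norm_le_norm_stack (v : Fin n → Vec p) : ∑ i, ‖v i‖ ≤ √n * ‖stack v‖ := by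
  refine le_of_sq_le_sq ?_ (by positivity)
  rw [mul_pow, Real.sq_sqrt n.cast_nonneg, norm_stack_sq]
  simpa using sq_sum_le_card_mul_sum_sq (s := Finset.univ) (f := fun i => ‖v i‖)

end Operators

/-! ### Smooth strongly convex functions -/

theorem abs_add_abs_le_max (a b : ℝ) : |a| + |b| ≤ max |a + b| |a - b| := by
  rw [le_max_iff]
  grind

section Convex

variable {E : Type*} [NormedAddCommGroup E] [InnerProductSpace ℝ E]

/-- Co-coercivity of a gradient-like map `g`: each of `x`, `y` is compared with the other one,
displaced by a multiple of `g x - g y`, and the resulting quadratic polynomial in that multiple has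
no two distinct roots. -/
theorem norm_sub_sq_le_mul_inner {φ : E → ℝ} {g : E → E} {L : ℝ}
    (hlow : ∀ x y, φ x + inner ℝ (g x) (y - x) ≤ φ y)
    (hup : ∀ x y, φ y ≤ φ x + inner ℝ (g x) (y - x) + L / 2 * ‖y - x‖ ^ 2) (x y : E) :
    ‖g x - g y‖ ^ 2 ≤ L * inner ℝ (g x - g y) (x - y) := by
  have htest (u v d : E) : inner ℝ (g u - g v) d ≤
      φ v - φ u + inner ℝ (g u) (u - v) + L / 2 * ‖d‖ ^ 2 := by
    have h₁ := hlow u (v + d)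
    have h₂ := hup v (v + d)
    rw [add_sub_cancel_left] at h₂
    rw [show v + d - u = d - (u - v) by abel, inner_sub_right] at h₁
    rw [inner_sub_left]
    linarith
  set G := g x - g y with hG
  have hquad (t : ℝ) :
      0 ≤ L * ‖G‖ ^ 2 * (t * t) + -2 * ‖G‖ ^ 2 * t + inner ℝ G (x - y) := by
    have h₁ := htest x y (t • G)
    have h₂ := htest y x (-(t • G))
    rw [← neg_sub (g x), inner_neg_neg, norm_neg, ← hG, ← neg_sub x, inner_neg_right] at h₂
    rw [← hG] at h₁
    simp only [inner_smul_right, real_inner_self_eq_norm_sq, norm_smul, mul_pow, Real.norm_eq_abs,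
      sq_abs] at h₁ h₂
    have h₃ : inner ℝ G (x - y) = inner ℝ (g x) (x - y) - inner ℝ (g y) (x - y) :=
      inner_sub_left _ _ _
    linarith
  rcases eq_or_ne G 0 with h | h
  · simp [h]
  · have hpos : 0 < ‖G‖ ^ 2 := by positivity
    have hdiscrim := discrim_le_zero hquad
    rw [discrim] at hdiscrim
    exact le_of_mul_le_mul_left (by linarith) hpos

variable [CompleteSpace E]

/-- `f` is differentiable with a `β`-Lipschitz gradient, and `α`-strongly convex: the conditions
that `IsAdmissible` imposes on each local function; `α` and `β` may have any sign. -/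
structure IsSmoothStronglyConvex (f : E → ℝ) (α β : ℝ) : Prop where
  differentiable : Differentiable ℝ f
  lipschitz : ∀ x y, ‖∇ f x - ∇ f y‖ ≤ β * ‖x - y‖
  strongly_convex : ∀ x y, f x - f y ≤ inner ℝ (∇ f x) (x - y) - α / 2 * ‖x - y‖ ^ 2

theorem gradient_eq_zero_of_forall_le {f : E → ℝ} {z : E} (hz : ∀ w, f z ≤ f w) : ∇ f z = 0 := by
  have hmin : IsLocalMin f z := Eventually.of_forall hz
  rw [gradient, hmin.fderiv_eq_zero, map_zero]

namespace IsSmoothStronglyConvex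

variable {f : E → ℝ} {α β : ℝ}

theorem quadratic_le (hf : IsSmoothStronglyConvex f α β) (x y : E) :
    f x + inner ℝ (∇ f x) (y - x) + α / 2 * ‖y - x‖ ^ 2 ≤ f y := by
  have h := hf.strongly_convex x y
  rw [← neg_sub y x, inner_neg_right, norm_neg] at h
  linarith

theorem hasDerivAt_line (hf : IsSmoothStronglyConvex f α β) (x d : E) (t : ℝ) :
    HasDerivAt (fun t : ℝ => f (x + t • d)) (inner ℝ (∇ f (x + t • d)) d) t := by
  have hline : HasDerivAt (fun t : ℝ => x + t • d) d t := by
    simpa using ((hasDerivAt_id t).smul_const d).const_add x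
  have h := (hf.differentiable _).hasGradientAt.hasFDerivAt.comp_hasDerivAt t hline
  rwa [InnerProductSpace.toDual_apply_apply] at h

theorem le_quadratic (hf : IsSmoothStronglyConvex f α β) (x y : E) :
    f y ≤ f x + inner ℝ (∇ f x) (y - x) + β / 2 * ‖y - x‖ ^ 2 := by
  set d := y - x
  have hbound (t : ℝ) : HasDerivAt
      (fun t => f x + t * inner ℝ (∇ f x) d + β / 2 * ‖d‖ ^ 2 * t ^ 2)
      (inner ℝ (∇ f x) d + β * ‖d‖ ^ 2 * t) t := by
    refine ((((hasDerivAt_id t).mul_const (inner ℝ (∇ f x) d)).const_add (f x)).add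
      (((hasDerivAt_id t).pow 2).const_mul (β / 2 * ‖d‖ ^ 2))).congr_deriv ?_
    simp only [id]
    ring
  have hslope (t : ℝ) (ht : 0 ≤ t) :
      inner ℝ (∇ f (x + t • d)) d ≤ inner ℝ (∇ f x) d + β * ‖d‖ ^ 2 * t := by
    have hlip := hf.lipschitz (x + t • d) x
    rw [add_sub_cancel_left, norm_smul, Real.norm_of_nonneg ht] at hlip
    have hcs := (real_inner_le_norm (∇ f (x + t • d) - ∇ f x) d).trans
      (mul_le_mul_of_nonneg_right hlip (norm_nonneg d))
    rw [inner_sub_left] at hcs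
    linarith
  have h := image_le_of_deriv_right_le_deriv_boundary (a := 0) (b := 1)
    (fun t _ => (hf.hasDerivAt_line x d t).continuousAt.continuousWithinAt)
    (fun t _ => (hf.hasDerivAt_line x d t).hasDerivWithinAt) (by simp)
    (fun t _ => (hbound t).continuousAt.continuousWithinAt)
    (fun t _ => (hbound t).hasDerivWithinAt) (fun t ht => hslope t ht.1)
    (Set.right_mem_Icc.2 zero_le_one)
  simpa [d] using h

theorem alpha_le_beta [Nontrivial E] (hf : IsSmoothStronglyConvex f α β) : α ≤ β := by
  obtain ⟨x, y, hxy⟩ := exists_pair_ne E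
  have hpos : 0 < ‖y - x‖ ^ 2 := by
    have := sub_ne_zero.2 hxy.symm
    positivity
  refine le_of_mul_le_mul_right ?_ hpos
  linarith [hf.quadratic_le x y, hf.le_quadratic x y]

/-- Co-coercivity, applied to `f - α / 2 * ‖·‖ ^ 2`, puts `∇ f x - ∇ f y` in the ball that has the
segment from `α • (x - y)` to `β • (x - y)` as a diameter. -/
theorem norm_gradient_sub_sub_le (hf : IsSmoothStronglyConvex f α β) (x y : E) :
    ‖∇ f x - ∇ f y - ((α + β) / 2) • (x - y)‖ ≤ |(β - α) / 2| * ‖x - y‖ := by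
  have hsq (u v : E) : ‖v‖ ^ 2 = ‖u‖ ^ 2 + 2 * inner ℝ u (v - u) + ‖v - u‖ ^ 2 := by
    rw [← norm_add_sq_real, add_sub_cancel]
  have hcoc := norm_sub_sq_le_mul_inner (φ := fun u => f u - α / 2 * ‖u‖ ^ 2)
    (g := fun u => ∇ f u - α • u) (L := β - α)
    (fun u v => by
      rw [inner_sub_left, real_inner_smul_left]
      linarith [hf.quadratic_le u v, congrArg (α / 2 * ·) (hsq u v)])
    (fun u v => by
      rw [inner_sub_left, real_inner_smul_left]
      linarith [hf.le_quadratic u v, congrArg (α / 2 * ·) (hsq u v)]) x y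
  rw [show ∇ f x - α • x - (∇ f y - α • y) = ∇ f x - ∇ f y - α • (x - y) by module] at hcoc
  set G := ∇ f x - ∇ f y
  rw [norm_sub_sq_real, inner_sub_left G, inner_smul_right, real_inner_smul_left,
    real_inner_self_eq_norm_sq, norm_smul, mul_pow, Real.norm_eq_abs, sq_abs] at hcoc
  refine le_of_sq_le_sq ?_ (by positivity)
  rw [norm_sub_sq_real, inner_smul_right, norm_smul, mul_pow, mul_pow, Real.norm_eq_abs, sq_abs,
    sq_abs]
  linarith

theorem norm_gradient_step_le (hf : IsSmoothStronglyConvex f α β) (γ : ℝ) (x y : E) :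
    ‖x - y - γ • (∇ f x - ∇ f y)‖ ≤ max |1 - α * γ| |1 - β * γ| * ‖x - y‖ := by
  set c := 1 - γ * ((α + β) / 2) with hc
  set r := γ * ((β - α) / 2) with hr
  have hmax : |c| + |r| ≤ max |1 - α * γ| |1 - β * γ| := by
    convert abs_add_abs_le_max c r using 3 <;> rw [hc, hr] <;> ring
  calc ‖x - y - γ • (∇ f x - ∇ f y)‖
      = ‖c • (x - y) - γ • (∇ f x - ∇ f y - ((α + β) / 2) • (x - y))‖ := by
        congr 1
        module
    _ ≤ |c| * ‖x - y‖ + |γ| * ‖∇ f x - ∇ f y - ((α + β) / 2) • (x - y)‖ := by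
        refine (norm_sub_le _ _).trans_eq ?_
        rw [norm_smul, norm_smul, Real.norm_eq_abs, Real.norm_eq_abs]
    _ ≤ |c| * ‖x - y‖ + |γ| * (|(β - α) / 2| * ‖x - y‖) := by
        gcongr
        exact hf.norm_gradient_sub_sub_le x y
    _ = (|c| + |r|) * ‖x - y‖ := by
        rw [hr, abs_mul]
        ring
    _ ≤ max |1 - α * γ| |1 - β * γ| * ‖x - y‖ := by gcongr

theorem tendsto_cocompact [ProperSpace E] (hf : IsSmoothStronglyConvex f α β) (hα : 0 < α) :
    Tendsto f (cocompact E) atTop := by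
  have hquad : Tendsto (fun t : ℝ => f 0 + t * (α / 2 * t - ‖∇ f 0‖)) atTop atTop :=
    tendsto_atTop_add_const_left _ _ <| tendsto_id.atTop_mul_atTop₀ <|
      tendsto_atTop_add_const_right _ _ <| tendsto_id.const_mul_atTop (half_pos hα)
  refine tendsto_atTop_mono (fun w => ?_) (hquad.comp (tendsto_norm_cocompact_atTop (E := E)))
  have hlow := hf.quadratic_le 0 w
  have hinner := neg_le_of_abs_le (abs_real_inner_le_norm (∇ f 0) w)
  rw [sub_zero] at hlow
  simp only [Function.comp_apply]
  linarith

theorem existsUnique_minimizer [ProperSpace E] (hf : IsSmoothStronglyConvex f α β) (hα : 0 < α) :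
    ∃! z, ∀ w, f z ≤ f w := by
  obtain ⟨z, hz⟩ := hf.differentiable.continuous.exists_forall_le (hf.tendsto_cocompact hα)
  refine ⟨z, hz, fun w hw => ?_⟩
  have hquad := hf.quadratic_le z w
  rw [gradient_eq_zero_of_forall_le hz, inner_zero_left] at hquad
  have hsq : ‖w - z‖ ^ 2 ≤ 0 :=
    nonpos_of_mul_nonpos_right (by linarith [hw z]) (half_pos hα)
  simpa [sub_eq_zero] using le_antisymm hsq (sq_nonneg _)

end IsSmoothStronglyConvex

end Convex

section Objective

variable {n p : ℕ} {f : Fin n → Vec p → ℝ} {α β : ℝ} {z : Vec p}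

namespace IsAdmissible

theorem isSmoothStronglyConvex (hf : IsAdmissible f α β) (i : Fin n) :
    IsSmoothStronglyConvex (f i) α β :=
  ⟨hf.differentiable i, hf.lipschitz i, hf.strongly_convex i⟩

theorem hasGradientAt_objective (hf : IsAdmissible f α β) (z : Vec p) :
    HasGradientAt (objective f) ((1 / n : ℝ) • ∑ i, ∇ (f i) z) z := by
  rw [hasGradientAt_iff_hasFDerivAt, map_smul, map_sum]
  exact .const_smul (.fun_sum fun i _ => (hf.differentiable i z).hasGradientAt.hasFDerivAt)
    (1 / n : ℝ)

theorem isSmoothStronglyConvex_objective [NeZero n] (hf : IsAdmissible f α β) :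
    IsSmoothStronglyConvex (objective f) α β := by
  have hn : (n : ℝ) ≠ 0 := NeZero.ne _
  refine ⟨fun z => (hf.hasGradientAt_objective z).differentiableAt, fun z w => ?_, fun z w => ?_⟩
  · rw [(hf.hasGradientAt_objective z).gradient, (hf.hasGradientAt_objective w).gradient,
      ← smul_sub, ← Finset.sum_sub_distrib, norm_smul, Real.norm_of_nonneg (by positivity)]
    calc (1 / n : ℝ) * ‖∑ i, (∇ (f i) z - ∇ (f i) w)‖
        ≤ (1 / n : ℝ) * ∑ _i : Fin n, β * ‖z - w‖ := by
          gcongr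
          exact norm_sum_le_of_le _ fun i _ => hf.lipschitz i z w
      _ = β * ‖z - w‖ := by
          simp
          field_simp
  · rw [(hf.hasGradientAt_objective z).gradient]
    calc objective f z - objective f w = (1 / n : ℝ) * ∑ i, (f i z - f i w) := by
          rw [Finset.sum_sub_distrib, mul_sub]
          rfl
      _ ≤ (1 / n : ℝ) * ∑ i, (inner ℝ (∇ (f i) z) (z - w) - α / 2 * ‖z - w‖ ^ 2) := by
          exact mul_le_mul_of_nonneg_left
            (Finset.sum_le_sum fun i _ => hf.strongly_convex i z w) (by positivity)
      _ = _ := by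
          rw [Finset.sum_sub_distrib, ← sum_inner, real_inner_smul_left]
          simp
          field_simp

theorem existsUnique_isOptimal [NeZero n] (hf : IsAdmissible f α β) : ∃! z, IsOptimal f z :=
  hf.isSmoothStronglyConvex_objective.existsUnique_minimizer hf.alpha_pos

theorem sum_gradient_eq_smul_gradient [NeZero n] (hf : IsAdmissible f α β) (x : Vec p) :
    ∑ i, ∇ (f i) x = (n : ℝ) • ∇ (objective f) x := by
  rw [(hf.hasGradientAt_objective x).gradient, smul_smul,
    mul_one_div_cancel (NeZero.ne (n : ℝ)), one_smul]

theorem norm_sum_gradient_step_le [NeZero n] (hf : IsAdmissible f α β) (hz : IsOptimal f z)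
    (γ : ℝ) (x : Vec p) :
    ‖x - z - γ • ∑ i, ∇ (f i) x‖ ≤ max |1 - α * (n * γ)| |1 - β * (n * γ)| * ‖x - z‖ := by
  have h := hf.isSmoothStronglyConvex_objective.norm_gradient_step_le (n * γ) x z
  rwa [gradient_eq_zero_of_forall_le hz, sub_zero, mul_comm (n : ℝ) γ, mul_smul,
    ← hf.sum_gradient_eq_smul_gradient, mul_comm γ] at h

theorem sum_gradient_eq_zero [NeZero n] (hf : IsAdmissible f α β) (hz : IsOptimal f z) :
    ∑ i, ∇ (f i) z = 0 := by
  rw [hf.sum_gradient_eq_smul_gradient, gradient_eq_zero_of_forall_le hz, smul_zero]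

theorem norm_sum_gradient_sub_le (hf : IsAdmissible f α β) (v : Fin n → Vec p) (u : Vec p) :
    ‖∑ i, ∇ (f i) u - ∑ i, ∇ (f i) (v i)‖ ≤ β * (√n * ‖stack v - stack fun _ => u‖) := by
  rw [← Finset.sum_sub_distrib]
  calc ‖∑ i, (∇ (f i) u - ∇ (f i) (v i))‖ ≤ ∑ i, β * ‖v i - u‖ :=
        norm_sum_le_of_le _ fun i _ => norm_sub_rev u (v i) ▸ hf.lipschitz i u (v i)
    _ ≤ β * (√n * ‖stack v - stack fun _ => u‖) := by
        rw [← Finset.mul_sum]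
        exact mul_le_mul_of_nonneg_left (sum_norm_le_norm_stack _) hf.beta_pos.le

theorem alpha_le_beta [NeZero n] [NeZero p] (hf : IsAdmissible f α β) : α ≤ β :=
  (hf.isSmoothStronglyConvex 0).alpha_le_beta

end IsAdmissible

end Objective

/-! ### Perron's theorem -/

section Perron

variable {ι : Type*} [Fintype ι] {J : Matrix ι ι ℝ} {v w : ι → ℝ} {r s : ℝ}

theorem mulVec_mono (hJ : ∀ i j, 0 ≤ J i j) (h : v ≤ w) : J *ᵥ v ≤ J *ᵥ w := fun i =>
  Finset.sum_le_sum fun j _ => mul_le_mul_of_nonneg_left (h j) (hJ i j)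

theorem mulVec_pos (hJ : ∀ i j, 0 < J i j) (hv : 0 ≤ v) (hv0 : v ≠ 0) (i : ι) :
    0 < (J *ᵥ v) i := by
  obtain ⟨j, hj⟩ := Function.ne_iff.1 hv0
  exact Finset.sum_pos' (fun l _ => mul_nonneg (hJ i l).le (hv l))
    ⟨j, Finset.mem_univ j, mul_pos (hJ i j) ((hv j).lt_of_ne' hj)⟩

section CollatzWielandt

variable [Nonempty ι]

/-- The Collatz–Wielandt number of a matrix `J` at a positive vector `w`, the least `r` such that
`J w ≤ r w`. A zero coordinate of `w` contributes the junk value `0`. -/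
noncomputable def collatzWielandt (J : Matrix ι ι ℝ) (w : ι → ℝ) : ℝ :=
  Finset.univ.sup' Finset.univ_nonempty fun i => (J *ᵥ w) i / w i

theorem collatzWielandt_le_iff (hw : ∀ i, 0 < w i) :
    collatzWielandt J w ≤ r ↔ J *ᵥ w ≤ r • w := by
  simp [collatzWielandt, Finset.sup'_le_iff, div_le_iff₀ (hw _), Pi.le_def]

theorem collatzWielandt_lt_iff (hw : ∀ i, 0 < w i) :
    collatzWielandt J w < r ↔ ∀ i, (J *ᵥ w) i < r * w i := by
  simp [collatzWielandt, Finset.sup'_lt_iff, div_lt_iff₀ (hw _)]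

theorem collatzWielandt_smul {c : ℝ} (hc : c ≠ 0) :
    collatzWielandt J (c • w) = collatzWielandt J w := by
  simp [collatzWielandt, Matrix.mulVec_smul, mul_div_mul_left _ _ hc]

theorem continuousOn_collatzWielandt {K : Set (ι → ℝ)} (hK : ∀ w ∈ K, ∀ i, 0 < w i) :
    ContinuousOn (collatzWielandt J) K := by
  refine ContinuousOn.finset_sup'_apply _ fun i _ => ?_
  have hnum : Continuous fun w : ι → ℝ => (J *ᵥ w) i :=
    (continuous_apply i).comp (continuous_const.matrix_mulVec continuous_id)
  exact hnum.continuousOn.div (continuous_apply i).continuousOn fun w hw => (hK w hw i).ne'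

/-- Unless `w` is an eigenvector, `J` is applied to the nonnegative nonzero vector `r w - J w`,
where `r` is the Collatz–Wielandt number of `w`. -/
theorem collatzWielandt_mulVec_lt (hJ : ∀ i j, 0 < J i j) (hw : ∀ i, 0 < w i)
    (h : J *ᵥ w ≠ collatzWielandt J w • w) :
    collatzWielandt J (J *ᵥ w) < collatzWielandt J w := by
  have hw0 : w ≠ 0 := fun h0 => (hw (Classical.arbitrary ι)).ne' (congrFun h0 _)
  have hgap := mulVec_pos hJ (sub_nonneg.2 ((collatzWielandt_le_iff hw).1 le_rfl))
    (sub_ne_zero.2 h.symm)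
  refine (collatzWielandt_lt_iff (mulVec_pos hJ (fun i => (hw i).le) hw0)).2 fun i => ?_
  simpa [Matrix.mulVec_sub, Matrix.mulVec_smul] using hgap i

theorem exists_pos_mulVec_eq_smul (hJ : ∀ i j, 0 < J i j) :
    ∃ (r : ℝ) (v : ι → ℝ), (∀ i, 0 < v i) ∧ J *ᵥ v = r • v := by
  classical
  set K := (J *ᵥ ·) '' stdSimplex ℝ ι
  have hKpos : ∀ w ∈ K, ∀ i, 0 < w i := by
    rintro _ ⟨u, hu, rfl⟩
    refine mulVec_pos hJ hu.1 ?_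
    rintro rfl
    simpa using hu.2
  have hKcompact : IsCompact K := (isCompact_stdSimplex ℝ ι).image (by fun_prop)
  have hKne : K.Nonempty := ⟨_, _, single_mem_stdSimplex ℝ (Classical.arbitrary ι), rfl⟩
  obtain ⟨w, hwK, hmin⟩ := hKcompact.exists_isMinOn hKne (continuousOn_collatzWielandt hKpos)
  have hw := hKpos w hwK
  refine ⟨collatzWielandt J w, w, hw, ?_⟩
  by_contra hne
  have hsum : 0 < ∑ i, w i := Finset.sum_pos (fun i _ => hw i) Finset.univ_nonempty
  have hmem : J *ᵥ ((∑ i, w i)⁻¹ • w) ∈ K := by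
    refine ⟨_, ⟨fun i => mul_nonneg (inv_nonneg.2 hsum.le) (hw i).le, ?_⟩, rfl⟩
    simp [← Finset.mul_sum, hsum.ne']
  have hle := isMinOn_iff.1 hmin _ hmem
  rw [Matrix.mulVec_smul, collatzWielandt_smul (inv_ne_zero hsum.ne')] at hle
  exact (collatzWielandt_mulVec_lt hJ hw hne).not_ge hle

end CollatzWielandt

theorem le_of_smul_le_mulVec (hJ : ∀ i j, 0 ≤ J i j) (hw : ∀ i, 0 < w i) (hJw : J *ᵥ w ≤ r • w)
    (hv : 0 ≤ v) (hv0 : v ≠ 0) (hJv : s • v ≤ J *ᵥ v) : s ≤ r := by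
  obtain ⟨j, hj⟩ := Function.ne_iff.1 hv0
  have : Nonempty ι := ⟨j⟩
  obtain ⟨i, hi⟩ := Finite.exists_max fun i => v i / w i
  set M := v i / w i with hM
  have hMpos : 0 < M := (div_pos ((hv j).lt_of_ne' hj) (hw j)).trans_le (hi j)
  have hvw : v ≤ M • w := fun l => (div_le_iff₀ (hw l)).1 (hi l)
  have hvi : v i = M * w i := by rw [hM, div_mul_cancel₀ _ (hw i).ne']
  refine le_of_mul_le_mul_right ?_ (mul_pos hMpos (hw i))
  calc s * (M * w i) = (s • v) i := by rw [← hvi]; rfl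
    _ ≤ (J *ᵥ (M • w)) i := (hJv i).trans (mulVec_mono hJ hvw i)
    _ = M * (J *ᵥ w) i := by rw [Matrix.mulVec_smul]; rfl
    _ ≤ M * (r * w i) := mul_le_mul_of_nonneg_left (hJw i) hMpos.le
    _ = r * (M * w i) := by ring

variable [DecidableEq ι]

theorem mem_spectrum_iff_exists_mulVec {K : Type*} [Field K] {M : Matrix ι ι K} {μ : K} :
    μ ∈ spectrum K M ↔ ∃ z : ι → K, z ≠ 0 ∧ M *ᵥ z = μ • z := by
  rw [← Matrix.spectrum_toLin', ← Module.End.hasEigenvalue_iff_mem_spectrum]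
  refine ⟨fun h => ?_, fun ⟨z, hz, hMz⟩ => Module.End.hasEigenvalue_of_hasEigenvector
    (Module.End.hasEigenvector_iff.2 ⟨Module.End.mem_eigenspace_iff.2 hMz, hz⟩)⟩
  obtain ⟨z, hz⟩ := h.exists_hasEigenvector
  exact ⟨z, hz.2, hz.apply_eq_smul⟩

theorem spectralRadius_le_of_mulVec_le (hJ : ∀ i j, 0 ≤ J i j) (hw : ∀ i, 0 < w i)
    (hJw : J *ᵥ w ≤ r • w) :
    spectralRadius ℂ (J.map (fun r : ℝ => (r : ℂ))) ≤ ENNReal.ofReal r := by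
  refine iSup₂_le fun μ hμ => ?_
  obtain ⟨z, hz0, hz⟩ := mem_spectrum_iff_exists_mulVec.1 hμ
  rw [← enorm_eq_nnnorm, ← ofReal_norm]
  refine ENNReal.ofReal_le_ofReal (le_of_smul_le_mulVec hJ hw hJw (v := fun i => ‖z i‖)
    (fun i => norm_nonneg _) (fun h => hz0 (funext fun i => norm_eq_zero.1 (congrFun h i)))
    fun i => ?_)
  calc ‖μ‖ * ‖z i‖ = ‖∑ j, (J i j : ℂ) * z j‖ := by
        rw [← norm_mul]
        exact congrArg norm (congrFun hz i).symm
    _ ≤ ∑ j, J i j * ‖z j‖ := by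
        refine norm_sum_le_of_le _ fun j _ => ?_
        rw [norm_mul, Complex.norm_of_nonneg (hJ i j)]

theorem le_spectralRadius_of_mulVec_eq (hv : v ≠ 0) (h : J *ᵥ v = r • v) :
    ENNReal.ofReal r ≤ spectralRadius ℂ (J.map (fun r : ℝ => (r : ℂ))) := by
  have hmem : (r : ℂ) ∈ spectrum ℂ (J.map (fun r : ℝ => (r : ℂ))) := by
    refine mem_spectrum_iff_exists_mulVec.2 ⟨fun i => (v i : ℂ), ?_, funext fun i => ?_⟩
    · exact fun h0 => hv (funext fun i => Complex.ofReal_eq_zero.1 (congrFun h0 i))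
    · have hi := congrFun h i
      simp only [Matrix.mulVec, dotProduct, Pi.smul_apply, smul_eq_mul, Matrix.map_apply] at hi ⊢
      exact_mod_cast hi
  calc ENNReal.ofReal r ≤ ‖(r : ℂ)‖ₑ := by
        rw [← ofReal_norm, Complex.norm_real]
        exact ENNReal.ofReal_le_ofReal (le_abs_self r)
    _ ≤ _ := le_iSup₂ (f := fun k (_ : k ∈ spectrum ℂ _) => (‖k‖₊ : ENNReal)) (r : ℂ) hmem

theorem spectralRadius_lt_one_of_mulVec_lt [Nonempty ι] (hJ : ∀ i j, 0 ≤ J i j)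
    (hw : ∀ i, 0 < w i) (h : ∀ i, (J *ᵥ w) i < w i) :
    spectralRadius ℂ (J.map (fun r : ℝ => (r : ℂ))) < 1 := by
  have hlt : collatzWielandt J w < 1 := (collatzWielandt_lt_iff hw).2 (by simpa using h)
  exact (spectralRadius_le_of_mulVec_le hJ hw ((collatzWielandt_le_iff hw).1 le_rfl)).trans_lt
    (ENNReal.ofReal_lt_one.2 hlt)

theorem exists_pos_mulVec_eq_spectralRadius_smul [Nonempty ι] (hJ : ∀ i j, 0 < J i j) :
    ∃ v : ι → ℝ, (∀ i, 0 < v i) ∧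
      J *ᵥ v = (spectralRadius ℂ (J.map (fun r : ℝ => (r : ℂ)))).toReal • v := by
  obtain ⟨r, v, hv, hJv⟩ := exists_pos_mulVec_eq_smul hJ
  obtain ⟨i⟩ := ‹Nonempty ι›
  have hv0 : v ≠ 0 := fun h0 => (hv i).ne' (congrFun h0 i)
  have hr : 0 ≤ r := by
    have hpos : 0 < (r • v) i := hJv ▸ mulVec_pos hJ (fun i => (hv i).le) hv0 i
    exact (pos_of_mul_pos_left hpos (hv i).le).le
  have hρ := (spectralRadius_le_of_mulVec_le (fun i j => (hJ i j).le) hv hJv.le).antisymm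
    (le_spectralRadius_of_mulVec_eq hv0 hJv)
  exact ⟨v, hv, by rw [hρ, ENNReal.toReal_ofReal hr, hJv]⟩

theorem exists_le_spectralRadius_pow_smul [Nonempty ι] (hJ : ∀ i j, 0 < J i j) {t : ℕ → ι → ℝ}
    (ht : ∀ k, t (k + 1) ≤ J *ᵥ t k) :
    ∃ v : ι → ℝ, ∀ k, t k ≤ (spectralRadius ℂ (J.map (fun r : ℝ => (r : ℂ)))).toReal ^ k • v := by
  obtain ⟨v, hv, hJv⟩ := exists_pos_mulVec_eq_spectralRadius_smul hJ
  obtain ⟨i, hi⟩ := Finite.exists_max fun i => t 0 i / v i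
  refine ⟨(t 0 i / v i) • v, fun k => ?_⟩
  induction k with
  | zero =>
    rw [pow_zero, one_smul]
    exact fun j => (div_le_iff₀ (hv j)).1 (hi j)
  | succ k ih =>
    refine (ht k).trans ((mulVec_mono (fun i j => (hJ i j).le) ih).trans_eq ?_)
    rw [Matrix.mulVec_smul, Matrix.mulVec_smul, hJv, pow_succ, mul_smul,
      smul_comm (t 0 i / v i) _ v]

end Perron

/-! ### The error recursion -/

section ErrorNorms

variable {n p : ℕ} {X P : BigMatrix n p} {N : Seminorm ℝ (StackedVec n p)} {σ : ℝ}

theorem toOp_toOp_of_tendsto_pow (h : Tendsto (fun k : ℕ => X ^ k) atTop (𝓝 P))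
    (v : StackedVec n p) : toOp P (toOp X v) = toOp P v := by
  rw [← mul_apply_eq_comp, ← toOp_mul, limit_mul_of_tendsto_pow h]

theorem toOp_toOp_limit_of_tendsto_pow (h : Tendsto (fun k : ℕ => X ^ k) atTop (𝓝 P))
    (v : StackedVec n p) : toOp X (toOp P v) = toOp P v := by
  rw [← mul_apply_eq_comp, ← toOp_mul, mul_limit_of_tendsto_pow h]

theorem toOp_sub_apply_of_tendsto_pow (h : Tendsto (fun k : ℕ => X ^ k) atTop (𝓝 P))
    (v : StackedVec n p) : toOp (X - P) (v - toOp P v) = toOp X v - toOp P v := by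
  have hidem : toOp P (toOp P v) = toOp P v := by
    rw [← mul_apply_eq_comp, ← toOp_mul, (isIdempotentElem_of_tendsto_pow h).eq]
  rw [toOp_sub, sub_apply, map_sub, map_sub, toOp_toOp_limit_of_tendsto_pow h, hidem]
  abel

theorem toOp_sub_one_apply_of_tendsto_pow (h : Tendsto (fun k : ℕ => X ^ k) atTop (𝓝 P))
    (v : StackedVec n p) : toOp (X - 1) (v - toOp P v) = toOp X v - v := by
  rw [toOp_sub, toOp_one, sub_apply, map_sub, toOp_toOp_limit_of_tendsto_pow h, one_apply_eq_self]
  abel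

theorem IsContractionNorm.map_toOp_sub_le (hN : IsContractionNorm X N σ)
    (h : Tendsto (fun k : ℕ => X ^ k) atTop (𝓝 P)) (v : StackedVec n p) :
    N (toOp (X - P) v) ≤ σ * N v :=
  (h.limUnder_eq : infPow X = P) ▸ hN.bound v

theorem IsContractionNorm.consensus_step_le (hN : IsContractionNorm X N σ)
    (h : Tendsto (fun k : ℕ => X ^ k) atTop (𝓝 P)) {m : ℝ} (hm : 0 ≤ m)
    (le_m : ∀ v, N v ≤ m * ‖v‖) {η : ℝ} (hη : 0 ≤ η) (x y : StackedVec n p) :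
    N (toOp X x - η • y - toOp P (toOp X x - η • y)) ≤
      σ * N (x - toOp P x) + m * (specNorm (1 - P) * (η * ‖y‖)) := by
  have hsplit : toOp X x - η • y - toOp P (toOp X x - η • y) =
      toOp (X - P) (x - toOp P x) - toOp (1 - P) (η • y) := by
    rw [toOp_sub_apply_of_tendsto_pow h, map_sub, toOp_toOp_of_tendsto_pow h, toOp_sub 1 P,
      toOp_one, sub_apply, one_apply_eq_self]
    abel
  rw [hsplit]
  refine (map_sub_le_add N _ _).trans (add_le_add (hN.map_toOp_sub_le h _) ((le_m _).trans ?_))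
  refine mul_le_mul_of_nonneg_left ((norm_toOp_le _ _).trans_eq ?_) hm
  rw [norm_smul, Real.norm_of_nonneg hη]

theorem IsContractionNorm.tracking_step_le (hN : IsContractionNorm X N σ)
    (h : Tendsto (fun k : ℕ => X ^ k) atTop (𝓝 P)) {l : ℝ} (le_l : ∀ v, N v ≤ l * ‖v‖)
    (y d : StackedVec n p) :
    N (toOp X (y + d) - toOp P (toOp X (y + d))) ≤ σ * N (y - toOp P y) + σ * (l * ‖d‖) := by
  have hsplit : toOp X (y + d) - toOp P (toOp X (y + d)) =
      toOp (X - P) (y - toOp P y) + toOp (X - P) d := by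
    rw [toOp_toOp_of_tendsto_pow h, toOp_sub_apply_of_tendsto_pow h, toOp_sub, sub_apply, map_add,
      map_add]
    abel
  rw [hsplit]
  refine (map_add_le_add N _ _).trans
    (add_le_add (hN.map_toOp_sub_le h _) ((hN.map_toOp_sub_le h _).trans ?_))
  exact mul_le_mul_of_nonneg_left (le_l d) hN.sigma_pos.le

theorem IsEquivConsts.norm_sub_le {NA NB : Seminorm ℝ (StackedVec n p)} {g h l m : ℝ}
    (hc : IsEquivConsts NA NB g h l m) (P : BigMatrix n p) (x w : StackedVec n p) :
    ‖x - w‖ ≤ g * NA (x - toOp P x) + ‖toOp P x - w‖ :=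
  (norm_sub_le_norm_sub_add_norm_sub _ _ _).trans (add_le_add_left (hc.le_g _) _)

end ErrorNorms

section Limits

variable {n p : ℕ} {G : Digraph (Fin n)} {A B : Matrix (Fin n) (Fin n) ℝ} {π : Fin n → ℝ}

/-- The limit `(1 πrᵀ) ⊗ I_p` of the powers of `A ⊗ I_p`, where `πr` is the left eigenvector
of `A`. -/
def consensusLimit (p : ℕ) (πr : Fin n → ℝ) : BigMatrix n p :=
  kronI p (Matrix.replicateRow (Fin n) πr)

/-- The limit `(πc 1ᵀ) ⊗ I_p` of the powers of `B ⊗ I_p`, where `πc` is the right eigenvector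
of `B`. -/
def trackingLimit (p : ℕ) (πc : Fin n → ℝ) : BigMatrix n p :=
  kronI p (Matrix.replicateCol (Fin n) πc)

theorem IsRowWeights.tendsto_kronI_pow (hA : IsRowWeights G A) (hG : StronglyConnected G)
    (hπ : IsLeftEigvec A π) :
    Tendsto (fun k : ℕ => kronI p A ^ k) atTop (𝓝 (consensusLimit p π)) :=
  DirOpt.tendsto_kronI_pow (hA.tendsto_pow hG hπ)

theorem IsColWeights.tendsto_kronI_pow (hB : IsColWeights G B) (hG : StronglyConnected G)
    (hπ : IsRightEigvec B π) :
    Tendsto (fun k : ℕ => kronI p B ^ k) atTop (𝓝 (trackingLimit p π)) :=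
  DirOpt.tendsto_kronI_pow (hB.tendsto_pow hG hπ)

theorem toOp_consensusLimit_stack (πr : Fin n → ℝ) (v : Fin n → Vec p) :
    toOp (consensusLimit p πr) (stack v) = stack fun _ => ∑ j, πr j • v j :=
  toOp_kronI_stack _ v

theorem toOp_trackingLimit_stack (πc : Fin n → ℝ) (v : Fin n → Vec p) :
    toOp (trackingLimit p πc) (stack v) = stack fun i => πc i • ∑ j, v j := by
  simp only [Finset.smul_sum]
  exact toOp_kronI_stack _ v

theorem toOp_consensusLimit_toOp_trackingLimit_stack (πr πc : Fin n → ℝ) (v : Fin n → Vec p) :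
    toOp (consensusLimit p πr) (toOp (trackingLimit p πc) (stack v)) =
      stack fun _ => (πr ⬝ᵥ πc) • ∑ j, v j := by
  rw [toOp_trackingLimit_stack, toOp_consensusLimit_stack]
  simp only [smul_smul, ← Finset.sum_smul]
  rfl

end Limits

section StackedGradient

variable {n p : ℕ} {f : Fin n → Vec p → ℝ} {α β : ℝ} {z : Vec p}

/-- The stacked vector of the local gradients, `f i` being differentiated at `v i`. -/
noncomputable def stackedGradient (f : Fin n → Vec p → ℝ) (v : Fin n → Vec p) : StackedVec n p :=
  stack fun i => ∇ (f i) (v i)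

namespace IsAdmissible

theorem norm_stackedGradient_sub_le (hf : IsAdmissible f α β) (v w : Fin n → Vec p) :
    ‖stackedGradient f v - stackedGradient f w‖ ≤ β * ‖stack v - stack w‖ :=
  norm_stack_le (v := fun i => ∇ (f i) (v i) - ∇ (f i) (w i)) (w := fun i => v i - w i)
    hf.beta_pos.le fun i => hf.lipschitz i (v i) (w i)

theorem norm_toOp_trackingLimit_stackedGradient_le [NeZero n] (hf : IsAdmissible f α β)
    (hz : IsOptimal f z) (πc : Fin n → ℝ) (v : Fin n → Vec p) :
    ‖toOp (trackingLimit p πc) (stackedGradient f v)‖ ≤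
      specNorm (trackingLimit p πc) * (β * ‖stack v - stack fun _ => z‖) := by
  have hzero : toOp (trackingLimit p πc) (stackedGradient f fun _ => z) = 0 := by
    rw [stackedGradient, toOp_trackingLimit_stack, hf.sum_gradient_eq_zero hz]
    simp only [smul_zero]
    rfl
  rw [← sub_zero (toOp _ _), ← hzero, ← map_sub]
  exact (norm_toOp_le _ _).trans
    (mul_le_mul_of_nonneg_left (hf.norm_stackedGradient_sub_le _ _) (norm_nonneg _))

theorem norm_inexact_step_le [NeZero n] (hf : IsAdmissible f α β) (hz : IsOptimal f z) {γ : ℝ}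
    (hγ : 0 ≤ γ) (u : Vec p) (v : Fin n → Vec p) :
    ‖u - z - γ • ∑ i, ∇ (f i) (v i)‖ ≤ max |1 - α * (n * γ)| |1 - β * (n * γ)| * ‖u - z‖ +
      γ * (β * (√n * ‖stack v - stack fun _ => u‖)) := by
  have hsplit : u - z - γ • ∑ i, ∇ (f i) (v i) = u - z - γ • ∑ i, ∇ (f i) u +
      γ • (∑ i, ∇ (f i) u - ∑ i, ∇ (f i) (v i)) := by module
  rw [hsplit]
  refine (norm_add_le _ _).trans (add_le_add (hf.norm_sum_gradient_step_le hz γ u) ?_)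
  rw [norm_smul, Real.norm_of_nonneg hγ]
  exact mul_le_mul_of_nonneg_left (hf.norm_sum_gradient_sub_le v u) hγ

theorem norm_stacked_inexact_step_le [NeZero n] (hf : IsAdmissible f α β) (hz : IsOptimal f z)
    {πr πc : Fin n → ℝ} {η : ℝ} (hη : 0 ≤ η * (πr ⬝ᵥ πc)) (v : Fin n → Vec p) :
    ‖toOp (consensusLimit p πr) (stack v) - stack (fun _ => z) -
        η • toOp (consensusLimit p πr) (toOp (trackingLimit p πc) (stackedGradient f v))‖ ≤
      max |1 - α * n * η * (πr ⬝ᵥ πc)| |1 - β * n * η * (πr ⬝ᵥ πc)| *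
        ‖toOp (consensusLimit p πr) (stack v) - stack fun _ => z‖ +
      η * (πr ⬝ᵥ πc) * β * n * ‖stack v - toOp (consensusLimit p πr) (stack v)‖ := by
  rw [stackedGradient, toOp_consensusLimit_toOp_trackingLimit_stack, toOp_consensusLimit_stack]
  set u := ∑ j, πr j • v j
  set c := πr ⬝ᵥ πc
  have hstack : stack (fun _ : Fin n => u) - stack (fun _ => z) -
      η • stack (fun _ => c • ∑ i, ∇ (f i) (v i)) =
      stack fun _ => u - z - (η * c) • ∑ i, ∇ (f i) (v i) := by
    simp only [mul_smul]
    rfl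
  have hdiff : stack (fun _ : Fin n => u) - stack (fun _ => z) = stack fun _ => u - z := rfl
  have hassoc (a : ℝ) : a * n * η * c = a * (n * (η * c)) := by ring
  rw [hstack, hdiff, norm_stack_const, norm_stack_const, hassoc, hassoc]
  refine (mul_le_mul_of_nonneg_left (hf.norm_inexact_step_le hz hη u v)
    (Real.sqrt_nonneg _)).trans_eq ?_
  linear_combination
    η * c * β * ‖stack v - stack fun _ => u‖ * Real.mul_self_sqrt (n.cast_nonneg (α := ℝ))

end IsAdmissible

end StackedGradient

section Algorithm

variable {n p : ℕ} {f : Fin n → Vec p → ℝ} {α β : ℝ} {z : Vec p}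
  {A B : Matrix (Fin n) (Fin n) ℝ} {η : ℝ} {x₀ : Fin n → Vec p}

theorem xIter_succ (k : ℕ) : xIter A B f η x₀ (k + 1) =
    toOp (kronI p A) (xIter A B f η x₀ k) - η • yIter A B f η x₀ k := by
  rw [xIter, xIter, toOp_kronI_stack]
  rfl

theorem yIter_succ (k : ℕ) : yIter A B f η x₀ (k + 1) =
    toOp (kronI p B) (yIter A B f η x₀ k + (stackedGradient f (iter A B f η x₀ (k + 1)).1 -
      stackedGradient f (iter A B f η x₀ k).1)) := by
  have hstack : yIter A B f η x₀ k + (stackedGradient f (iter A B f η x₀ (k + 1)).1 -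
      stackedGradient f (iter A B f η x₀ k).1) = stack fun j => (iter A B f η x₀ k).2 j +
        (∇ (f j) ((iter A B f η x₀ (k + 1)).1 j) - ∇ (f j) ((iter A B f η x₀ k).1 j)) := rfl
  rw [hstack, toOp_kronI_stack]
  simp only [← add_sub_assoc]
  rfl

/-- The gradient tracking property; it rests on the initialisation `y_i(0) = ∇ f_i (x_i(0))`. -/
theorem toOp_yIter {Q : BigMatrix n p} (hQ : Tendsto (fun k : ℕ => kronI p B ^ k) atTop (𝓝 Q))
    (k : ℕ) : toOp Q (yIter A B f η x₀ k) = toOp Q (stackedGradient f (iter A B f η x₀ k).1) := by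
  induction k with
  | zero => rfl
  | succ k ih =>
    rw [yIter_succ, toOp_toOp_of_tendsto_pow hQ, map_add, map_sub, ih, add_sub_cancel]

namespace IsAdmissible

theorem norm_yIter_le [NeZero n] (hf : IsAdmissible f α β) (hz : IsOptimal f z) {πc : Fin n → ℝ}
    (hQ : Tendsto (fun k : ℕ => kronI p B ^ k) atTop (𝓝 (trackingLimit p πc)))
    (P : BigMatrix n p) {NA NB : Seminorm ℝ (StackedVec n p)} {g h l m : ℝ}
    (hc : IsEquivConsts NA NB g h l m) (k : ℕ) :
    ‖yIter A B f η x₀ k‖ ≤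
      h * NB (yIter A B f η x₀ k - toOp (trackingLimit p πc) (yIter A B f η x₀ k)) +
      specNorm (trackingLimit p πc) *
        (β * (g * NA (xIter A B f η x₀ k - toOp P (xIter A B f η x₀ k)) +
          ‖toOp P (xIter A B f η x₀ k) - stack fun _ => z‖)) := by
  have htrack : ‖toOp (trackingLimit p πc) (yIter A B f η x₀ k)‖ ≤
      specNorm (trackingLimit p πc) * (β * ‖xIter A B f η x₀ k - stack fun _ => z‖) := by
    rw [toOp_yIter hQ]
    exact hf.norm_toOp_trackingLimit_stackedGradient_le hz πc _
  refine (norm_le_norm_sub_add _ _).trans (add_le_add (hc.le_h _) (htrack.trans ?_))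
  refine mul_le_mul_of_nonneg_left ?_ (norm_nonneg _)
  exact mul_le_mul_of_nonneg_left (hc.norm_sub_le P _ _) hf.beta_pos.le

theorem optimality_step_le [NeZero n] (hf : IsAdmissible f α β) (hz : IsOptimal f z)
    {πr πc : Fin n → ℝ} (hr : 0 ≤ πr ⬝ᵥ πc) (hη : 0 ≤ η)
    (hP : Tendsto (fun k : ℕ => kronI p A ^ k) atTop (𝓝 (consensusLimit p πr)))
    (hQ : Tendsto (fun k : ℕ => kronI p B ^ k) atTop (𝓝 (trackingLimit p πc))) (k : ℕ) :
    ‖toOp (consensusLimit p πr) (xIter A B f η x₀ (k + 1)) - stack fun _ => z‖ ≤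
      max |1 - α * n * η * (πr ⬝ᵥ πc)| |1 - β * n * η * (πr ⬝ᵥ πc)| *
        ‖toOp (consensusLimit p πr) (xIter A B f η x₀ k) - stack fun _ => z‖ +
      η * (πr ⬝ᵥ πc) * β * n *
        ‖xIter A B f η x₀ k - toOp (consensusLimit p πr) (xIter A B f η x₀ k)‖ +
      η * (specNorm (consensusLimit p πr) *
        ‖yIter A B f η x₀ k - toOp (trackingLimit p πc) (yIter A B f η x₀ k)‖) := by
  set P := consensusLimit p πr
  set Q := trackingLimit p πc
  set y := yIter A B f η x₀ k
  have hsplit : toOp P (xIter A B f η x₀ (k + 1)) - stack (fun _ => z) =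
      toOp P (xIter A B f η x₀ k) - stack (fun _ => z) -
        η • toOp P (toOp Q (stackedGradient f (iter A B f η x₀ k).1)) -
        η • toOp P (y - toOp Q y) := by
    rw [xIter_succ, map_sub, map_smul, toOp_toOp_of_tendsto_pow hP, map_sub, ← toOp_yIter hQ]
    module
  rw [hsplit]
  refine (norm_sub_le _ _).trans
    (add_le_add (hf.norm_stacked_inexact_step_le hz (mul_nonneg hη hr) _) ?_)
  rw [norm_smul, Real.norm_of_nonneg hη]
  exact mul_le_mul_of_nonneg_left (norm_toOp_le _ _) hη

theorem norm_stackedGradient_step_le (hf : IsAdmissible f α β) (hη : 0 ≤ η) {P : BigMatrix n p}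
    (hP : Tendsto (fun k : ℕ => kronI p A ^ k) atTop (𝓝 P)) (k : ℕ) :
    ‖stackedGradient f (iter A B f η x₀ (k + 1)).1 - stackedGradient f (iter A B f η x₀ k).1‖ ≤
      β * (specNorm (kronI p A - 1) * ‖xIter A B f η x₀ k - toOp P (xIter A B f η x₀ k)‖ +
        η * ‖yIter A B f η x₀ k‖) := by
  refine (hf.norm_stackedGradient_sub_le _ _).trans (mul_le_mul_of_nonneg_left ?_ hf.beta_pos.le)
  have hsplit : xIter A B f η x₀ (k + 1) - xIter A B f η x₀ k =
      toOp (kronI p A - 1) (xIter A B f η x₀ k - toOp P (xIter A B f η x₀ k)) -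
        η • yIter A B f η x₀ k := by
    rw [toOp_sub_one_apply_of_tendsto_pow hP, xIter_succ]
    abel
  change ‖xIter A B f η x₀ (k + 1) - xIter A B f η x₀ k‖ ≤ _
  rw [hsplit, ← Real.norm_of_nonneg hη, ← norm_smul, Real.norm_of_nonneg hη]
  exact (norm_sub_le _ _).trans (add_le_add_left (norm_toOp_le _ _) _)

end IsAdmissible

end Algorithm

section ErrorMatrix

variable {σA σB lam η a₁ a₂ a₃ a₄ a₅ a₆ a₇ a₈ a₉ : ℝ}

theorem errorMatrix_mulVec (t₁ t₂ t₃ : ℝ) :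
    errorMatrix σA σB lam η a₁ a₂ a₃ a₄ a₅ a₆ a₇ a₈ a₉ *ᵥ ![t₁, t₂, t₃] =
      ![(σA + a₁ * η) * t₁ + a₂ * η * t₂ + a₃ * η * t₃,
        a₄ * η * t₁ + lam * t₂ + a₅ * η * t₃,
        (a₆ + a₇ * η) * t₁ + a₈ * η * t₂ + (σB + a₉ * η) * t₃] := by
  ext i
  fin_cases i <;> simp [errorMatrix, Matrix.mulVec, dotProduct, Fin.sum_univ_three]

theorem errorMatrix_nonneg (hσA : 0 ≤ σA) (hσB : 0 ≤ σB) (hlam : 0 ≤ lam) (hη : 0 ≤ η)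
    (h₁ : 0 ≤ a₁) (h₂ : 0 ≤ a₂) (h₃ : 0 ≤ a₃) (h₄ : 0 ≤ a₄) (h₅ : 0 ≤ a₅) (h₆ : 0 ≤ a₆)
    (h₇ : 0 ≤ a₇) (h₈ : 0 ≤ a₈) (h₉ : 0 ≤ a₉) (i j : Fin 3) :
    0 ≤ errorMatrix σA σB lam η a₁ a₂ a₃ a₄ a₅ a₆ a₇ a₈ a₉ i j := by
  have h₁₁ : 0 ≤ σA + a₁ * η := by positivity
  have h₃₁ : 0 ≤ a₆ + a₇ * η := by positivity
  have h₃₃ : 0 ≤ σB + a₉ * η := by positivity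
  fin_cases i <;> fin_cases j <;> simp [errorMatrix, mul_nonneg, *]

theorem errorMatrix_pos (hσA : 0 ≤ σA) (hσB : 0 ≤ σB) (hlam : 0 < lam) (hη : 0 < η)
    (h₁ : 0 < a₁) (h₂ : 0 < a₂) (h₃ : 0 < a₃) (h₄ : 0 < a₄) (h₅ : 0 < a₅) (h₆ : 0 ≤ a₆)
    (h₇ : 0 < a₇) (h₈ : 0 < a₈) (h₉ : 0 < a₉) (i j : Fin 3) :
    0 < errorMatrix σA σB lam η a₁ a₂ a₃ a₄ a₅ a₆ a₇ a₈ a₉ i j := by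
  have h₁₁ : 0 < σA + a₁ * η := by positivity
  have h₃₁ : 0 < a₆ + a₇ * η := by positivity
  have h₃₃ : 0 < σB + a₉ * η := by positivity
  fin_cases i <;> fin_cases j <;> simp [errorMatrix, *]

theorem errorMatrix_mulVec_lt {c ε₁ ε₂ ε₃ : ℝ} (hη : 0 < η) (hc : 0 < c)
    (hpos₁ : 0 < a₁ * ε₁ + a₂ * ε₂ + a₃ * ε₃) (hpos₃ : 0 < a₇ * ε₁ + a₈ * ε₂ + a₉ * ε₃)
    (h₂ : (a₄ * ε₁ + a₅ * ε₃) / c < ε₂)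
    (h₁ : η < ε₁ * (1 - σA) / (a₁ * ε₁ + a₂ * ε₂ + a₃ * ε₃))
    (h₃ : η < ((1 - σB) * ε₃ - ε₁ * a₆) / (a₇ * ε₁ + a₈ * ε₂ + a₉ * ε₃)) (i : Fin 3) :
    (errorMatrix σA σB (1 - c * η) η a₁ a₂ a₃ a₄ a₅ a₆ a₇ a₈ a₉ *ᵥ ![ε₁, ε₂, ε₃]) i <
      ![ε₁, ε₂, ε₃] i := by
  rw [lt_div_iff₀ hpos₁] at h₁
  rw [lt_div_iff₀ hpos₃] at h₃
  have h₂' := mul_lt_mul_of_pos_left ((div_lt_iff₀ hc).1 h₂) hη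
  rw [errorMatrix_mulVec]
  fin_cases i <;> simp <;> linarith

theorem max_abs_one_sub_eq {a b : ℝ} (hab : a ≤ b) (hb : b ≤ 1) :
    max |1 - a| |1 - b| = 1 - a := by
  rw [abs_of_nonneg (by linarith), abs_of_nonneg (by linarith), max_eq_left (by linarith)]

theorem errorMatrix_pos_and_specRadius_lt_one {α β ν c ε₁ ε₂ ε₃ : ℝ} (hα : 0 < α) (hαβ : α ≤ β)
    (hν : 0 < ν) (hc : 0 < c) (hσA : 0 ≤ σA) (hσB : 0 ≤ σB)
    (ha : 0 < a₁ ∧ 0 < a₂ ∧ 0 < a₃ ∧ 0 < a₄ ∧ 0 < a₅ ∧ 0 < a₆ ∧ 0 < a₇ ∧ 0 < a₈ ∧ 0 < a₉)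
    (hε₁ : 0 < ε₁) (hε₂ : 0 < ε₂) (hε₃ : 0 < ε₃)
    (h₂ : (a₄ * ε₁ + a₅ * ε₃) / (α * ν * c) < ε₂) (hη : 0 < η)
    (hlt : η < min (ε₁ * (1 - σA) / (a₁ * ε₁ + a₂ * ε₂ + a₃ * ε₃))
      (min (((1 - σB) * ε₃ - ε₁ * a₆) / (a₇ * ε₁ + a₈ * ε₂ + a₉ * ε₃)) (1 / (ν * β * c))))
    {J : Matrix (Fin 3) (Fin 3) ℝ}
    (hJ : J = errorMatrix σA σB (max |1 - α * ν * η * c| |1 - β * ν * η * c|) η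
      a₁ a₂ a₃ a₄ a₅ a₆ a₇ a₈ a₉) :
    (∀ i j, 0 < J i j) ∧ specRadius J < 1 := by
  obtain ⟨ha₁, ha₂, ha₃, ha₄, ha₅, ha₆, ha₇, ha₈, ha₉⟩ := ha
  obtain ⟨h₁, h₃, hstep⟩ := by simpa only [lt_min_iff] using hlt
  have hβ := hα.trans_le hαβ
  have hle : α * ν * η * c ≤ β * ν * η * c := by gcongr
  have hlt_one : β * ν * η * c < 1 := by
    rw [lt_div_iff₀ (by positivity)] at hstep
    linarith
  rw [max_abs_one_sub_eq hle hlt_one.le, mul_right_comm (α * ν)] at hJ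
  have hJ_pos (i j : Fin 3) : 0 < J i j :=
    hJ ▸ errorMatrix_pos hσA hσB (by linarith) hη ha₁ ha₂ ha₃ ha₄ ha₅ ha₆.le ha₇ ha₈ ha₉ i j
  refine ⟨hJ_pos, spectralRadius_lt_one_of_mulVec_lt (w := ![ε₁, ε₂, ε₃])
    (fun i j => (hJ_pos i j).le) (by simp [Fin.forall_fin_succ, hε₁, hε₂, hε₃]) ?_⟩
  exact hJ ▸ errorMatrix_mulVec_lt hη (by positivity) (by positivity) (by positivity) h₂ h₁ h₃

end ErrorMatrix

section ErrorVec

variable {n p : ℕ} {f : Fin n → Vec p → ℝ} {α β : ℝ} {z : Vec p}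
  {A B : Matrix (Fin n) (Fin n) ℝ} {NA NB : Seminorm ℝ (StackedVec n p)} {g h l m : ℝ}

namespace IsAdmissible

theorem consensusError_succ_le [NeZero n] (hf : IsAdmissible f α β) (hz : IsOptimal f z)
    {P : BigMatrix n p} {πc : Fin n → ℝ} {σA : ℝ}
    (hP : Tendsto (fun k : ℕ => kronI p A ^ k) atTop (𝓝 P))
    (hQ : Tendsto (fun k : ℕ => kronI p B ^ k) atTop (𝓝 (trackingLimit p πc)))
    (hNA : IsContractionNorm (kronI p A) NA σA) (hc : IsEquivConsts NA NB g h l m)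
    {η : ℝ} (hη : 0 ≤ η) (x₀ : Fin n → Vec p) (k : ℕ) :
    NA (xIter A B f η x₀ (k + 1) - toOp P (xIter A B f η x₀ (k + 1))) ≤
      σA * NA (xIter A B f η x₀ k - toOp P (xIter A B f η x₀ k)) +
      m * (specNorm (1 - P) * (η *
        (h * NB (yIter A B f η x₀ k - toOp (trackingLimit p πc) (yIter A B f η x₀ k)) +
          specNorm (trackingLimit p πc) *
            (β * (g * NA (xIter A B f η x₀ k - toOp P (xIter A B f η x₀ k)) +
              ‖toOp P (xIter A B f η x₀ k) - stack fun _ => z‖))))) := by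
  rw [xIter_succ]
  refine (hNA.consensus_step_le hP hc.m_pos.le hc.le_m hη _ _).trans (add_le_add_right ?_ _)
  have hnorm : 0 ≤ specNorm (1 - P) := norm_nonneg _
  have := hc.m_pos
  gcongr
  exact hf.norm_yIter_le hz hQ P hc k

theorem trackingError_succ_le [NeZero n] (hf : IsAdmissible f α β) (hz : IsOptimal f z)
    {P : BigMatrix n p} {πc : Fin n → ℝ} {σB : ℝ}
    (hP : Tendsto (fun k : ℕ => kronI p A ^ k) atTop (𝓝 P))
    (hQ : Tendsto (fun k : ℕ => kronI p B ^ k) atTop (𝓝 (trackingLimit p πc)))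
    (hNB : IsContractionNorm (kronI p B) NB σB) (hc : IsEquivConsts NA NB g h l m)
    {η : ℝ} (hη : 0 ≤ η) (x₀ : Fin n → Vec p) (k : ℕ) :
    NB (yIter A B f η x₀ (k + 1) - toOp (trackingLimit p πc) (yIter A B f η x₀ (k + 1))) ≤
      σB * NB (yIter A B f η x₀ k - toOp (trackingLimit p πc) (yIter A B f η x₀ k)) +
      σB * (l * (β * (specNorm (kronI p A - 1) *
          (g * NA (xIter A B f η x₀ k - toOp P (xIter A B f η x₀ k))) + η *
        (h * NB (yIter A B f η x₀ k - toOp (trackingLimit p πc) (yIter A B f η x₀ k)) +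
          specNorm (trackingLimit p πc) *
            (β * (g * NA (xIter A B f η x₀ k - toOp P (xIter A B f η x₀ k)) +
              ‖toOp P (xIter A B f η x₀ k) - stack fun _ => z‖)))))) := by
  rw [yIter_succ]
  refine (hNB.tracking_step_le hQ hc.le_l _ _).trans (add_le_add_right ?_ _)
  have hnorm : 0 ≤ specNorm (kronI p A - 1) := norm_nonneg _
  have := hf.beta_pos
  have := hNB.sigma_pos
  have := hc.l_pos
  gcongr
  refine (hf.norm_stackedGradient_step_le hη hP k).trans ?_
  gcongr
  · exact hc.le_g _
  · exact hf.norm_yIter_le hz hQ P hc k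

theorem errorVec_succ_le [NeZero n] (hf : IsAdmissible f α β) (hz : IsOptimal f z)
    {πr πc : Fin n → ℝ} (hr : 0 ≤ πr ⬝ᵥ πc)
    (hP : Tendsto (fun k : ℕ => kronI p A ^ k) atTop (𝓝 (consensusLimit p πr)))
    (hQ : Tendsto (fun k : ℕ => kronI p B ^ k) atTop (𝓝 (trackingLimit p πc))) {σA σB : ℝ}
    (hNA : IsContractionNorm (kronI p A) NA σA) (hNB : IsContractionNorm (kronI p B) NB σB)
    (hc : IsEquivConsts NA NB g h l m) {η : ℝ} (hη : 0 ≤ η) (x₀ : Fin n → Vec p) (k : ℕ) :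
    errorVec (consensusLimit p πr) (trackingLimit p πc) NA NB z (xIter A B f η x₀ (k + 1))
        (yIter A B f η x₀ (k + 1)) ≤
      errorMatrix σA σB (max |1 - α * n * η * (πr ⬝ᵥ πc)| |1 - β * n * η * (πr ⬝ᵥ πc)|) η
        (m * g * β * specNorm (1 - consensusLimit p πr) * specNorm (trackingLimit p πc))
        (m * β * specNorm (1 - consensusLimit p πr) * specNorm (trackingLimit p πc))
        (m * h * specNorm (1 - consensusLimit p πr)) (n * β * g * (πr ⬝ᵥ πc))
        (h * specNorm (consensusLimit p πr)) (g * σB * l * β * specNorm (kronI p A - 1))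
        (g * σB * l * β ^ 2 * specNorm (trackingLimit p πc))
        (σB * l * β ^ 2 * specNorm (trackingLimit p πc)) (h * σB * l * β) *ᵥ
      errorVec (consensusLimit p πr) (trackingLimit p πc) NA NB z (xIter A B f η x₀ k)
        (yIter A B f η x₀ k) := by
  rw [errorVec, errorVec, errorMatrix_mulVec]
  intro i
  fin_cases i
  · refine (hf.consensusError_succ_le hz hP hQ hNA hc hη x₀ k).trans_eq ?_
    simp only [Nat.succ_eq_add_one, Nat.reduceAdd, Fin.zero_eta, Fin.isValue,
      Matrix.cons_val_zero]
    ring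
  · refine (hf.optimality_step_le hz hr hη hP hQ k).trans ?_
    have hnorm : 0 ≤ specNorm (consensusLimit p πr) := norm_nonneg _
    have := hf.beta_pos
    grw [hc.le_g (xIter A B f η x₀ k - toOp (consensusLimit p πr) (xIter A B f η x₀ k)),
      hc.le_h (yIter A B f η x₀ k - toOp (trackingLimit p πc) (yIter A B f η x₀ k))]
    simp only [Nat.succ_eq_add_one, Nat.reduceAdd, Fin.mk_one, Fin.isValue, Matrix.cons_val_one,
      Matrix.cons_val_zero]
    apply le_of_eq
    ring
  · refine (hf.trackingError_succ_le hz hP hQ hNB hc hη x₀ k).trans_eq ?_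
    simp only [Nat.succ_eq_add_one, Nat.reduceAdd, Fin.reduceFinMk, Matrix.cons_val]
    ring

end IsAdmissible

end ErrorVec

/-! ### Positivity of the constants and geometric convergence -/

section Positivity

variable {n p : ℕ} {G : Digraph (Fin n)} {A B : Matrix (Fin n) (Fin n) ℝ} {π πr πc : Fin n → ℝ}

theorem specNorm_kronI_pos (hp : p ≠ 0) (hA : A ≠ 0) : 0 < specNorm (kronI p A) := by
  refine specNorm_pos ?_
  rw [← (Matrix.zero_kronecker _ : kronI p (0 : Matrix (Fin n) (Fin n) ℝ) = 0)]
  exact (kronI_injective hp).ne hA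

theorem specNorm_consensusLimit_pos (hp : p ≠ 0) (hπ : π ≠ 0) :
    0 < specNorm (consensusLimit p π) := by
  obtain ⟨i, hi⟩ := Function.ne_iff.1 hπ
  exact specNorm_kronI_pos hp fun h => hi (congrFun₂ h i i)

theorem specNorm_trackingLimit_pos (hp : p ≠ 0) (hπ : π ≠ 0) :
    0 < specNorm (trackingLimit p π) := by
  obtain ⟨i, hi⟩ := Function.ne_iff.1 hπ
  exact specNorm_kronI_pos hp fun h => hi (congrFun₂ h i i)

theorem consensusLimit_ne_one [Nontrivial (Fin n)] (hp : p ≠ 0) (π : Fin n → ℝ) :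
    consensusLimit p π ≠ 1 := by
  obtain ⟨i, j, hij⟩ := exists_pair_ne (Fin n)
  rw [← kronI_one]
  refine (kronI_injective hp).ne fun h => zero_ne_one (α := ℝ) ?_
  calc (0 : ℝ) = Matrix.replicateRow (Fin n) π i j := by rw [h, Matrix.one_apply_ne hij]
    _ = Matrix.replicateRow (Fin n) π j j := rfl
    _ = 1 := by rw [h, Matrix.one_apply_eq]

theorem IsLeftEigvec.ne_zero (hπ : IsLeftEigvec A π) : π ≠ 0 := by
  rintro rfl
  simpa using hπ.2

theorem IsRightEigvec.ne_zero (hπ : IsRightEigvec B π) : π ≠ 0 := by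
  rintro rfl
  simpa using hπ.2

theorem IsLeftEigvec.dotProduct_pos [NeZero n] (hA : IsRowWeights G A) (hB : IsColWeights G B)
    (hG : StronglyConnected G) (hπr : IsLeftEigvec A πr) (hπc : IsRightEigvec B πc) :
    0 < πr ⬝ᵥ πc :=
  Finset.sum_pos (fun i _ => mul_pos (hA.leftEigvec_pos hG hπr i) (hB.rightEigvec_pos hG hπc i))
    Finset.univ_nonempty

theorem IsEquivConsts.recursionMatrix_nonneg {NA NB : Seminorm ℝ (StackedVec n p)}
    {g h l m : ℝ} (hc : IsEquivConsts NA NB g h l m) {β r σA σB lam η : ℝ} (hβ : 0 ≤ β)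
    (hr : 0 ≤ r) (hσA : 0 ≤ σA) (hσB : 0 ≤ σB) (hlam : 0 ≤ lam) (hη : 0 ≤ η)
    (X P Q : BigMatrix n p) (i j : Fin 3) :
    0 ≤ errorMatrix σA σB lam η
      (m * g * β * specNorm (1 - P) * specNorm Q) (m * β * specNorm (1 - P) * specNorm Q)
      (m * h * specNorm (1 - P)) (n * β * g * r) (h * specNorm P)
      (g * σB * l * β * specNorm (X - 1)) (g * σB * l * β ^ 2 * specNorm Q)
      (σB * l * β ^ 2 * specNorm Q) (h * σB * l * β) i j := by
  obtain ⟨hg, hh, hl, hm, -⟩ := hc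
  unfold specNorm
  apply errorMatrix_nonneg <;> positivity

theorem IsEquivConsts.recursionConsts_pos {NA NB : Seminorm ℝ (StackedVec n p)} {g h l m : ℝ}
    (hc : IsEquivConsts NA NB g h l m) (hn : 2 ≤ n) (hp : 1 ≤ p) {β σB : ℝ} (hβ : 0 < β)
    (hσB : 0 < σB) (hr : 0 < πr ⬝ᵥ πc) (hπr : πr ≠ 0) (hπc : πc ≠ 0)
    (hP : Tendsto (fun k : ℕ => kronI p A ^ k) atTop (𝓝 (consensusLimit p πr))) :
    0 < m * g * β * specNorm (1 - consensusLimit p πr) * specNorm (trackingLimit p πc) ∧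
    0 < m * β * specNorm (1 - consensusLimit p πr) * specNorm (trackingLimit p πc) ∧
    0 < m * h * specNorm (1 - consensusLimit p πr) ∧ 0 < n * β * g * (πr ⬝ᵥ πc) ∧
    0 < h * specNorm (consensusLimit p πr) ∧ 0 < g * σB * l * β * specNorm (kronI p A - 1) ∧
    0 < g * σB * l * β ^ 2 * specNorm (trackingLimit p πc) ∧
    0 < σB * l * β ^ 2 * specNorm (trackingLimit p πc) ∧ 0 < h * σB * l * β := by
  obtain ⟨hg, hh, hl, hm, -, -, -, -⟩ := hc
  have : Nontrivial (Fin n) := Fin.nontrivial_iff_two_le.2 hn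
  have hp : p ≠ 0 := Nat.ne_zero_of_lt hp
  have hP_ne_one := consensusLimit_ne_one hp πr
  have hsub := specNorm_pos (sub_ne_zero.2 hP_ne_one.symm)
  have hsub' := specNorm_pos (sub_ne_zero.2 (ne_one_of_tendsto_pow hP hP_ne_one))
  have hconsensus := specNorm_consensusLimit_pos hp hπr
  have htracking := specNorm_trackingLimit_pos hp hπc
  refine ⟨?_, ?_, ?_, ?_, ?_, ?_, ?_, ?_, ?_⟩ <;> positivity

theorem IsRowWeights.two_le_and_one_le (hA : IsRowWeights G A) (h : kronI p A ≠ 1) :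
    2 ≤ n ∧ 1 ≤ p := by
  contrapose! h
  by_cases hn : 2 ≤ n
  · have : p = 0 := Nat.lt_one_iff.1 (h hn)
    subst this
    exact Subsingleton.elim _ _
  · have : Subsingleton (Fin n) := Fin.subsingleton_iff_le_one.2 (by omega)
    have : A = 1 := by
      ext i j
      have := hA.row_sum i
      rw [Fintype.sum_subsingleton _ j] at this
      rw [this, Subsingleton.elim i j, Matrix.one_apply_eq]
    rw [this, kronI_one]

end Positivity

section Rates

variable {J : Matrix (Fin 3) (Fin 3) ℝ}

theorem tendsto_specRadius_toReal_pow (h : specRadius J < 1) :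
    Tendsto (fun k : ℕ => (specRadius J).toReal ^ k) atTop (𝓝 0) :=
  tendsto_pow_atTop_nhds_zero_of_lt_one ENNReal.toReal_nonneg
    (ENNReal.toReal_lt_of_lt_ofReal (by rwa [ENNReal.ofReal_one]))

theorem isBigO_norm_sub_stack {n p : ℕ} {P Q : BigMatrix n p}
    {NA NB : Seminorm ℝ (StackedVec n p)} {g h l m : ℝ} (hc : IsEquivConsts NA NB g h l m)
    (hJ : ∀ i j, 0 < J i j) {z : Vec p} {x y : ℕ → StackedVec n p}
    (hstep : ∀ k, errorVec P Q NA NB z (x (k + 1)) (y (k + 1)) ≤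
      J *ᵥ errorVec P Q NA NB z (x k) (y k)) :
    (fun k => ‖x k - stack fun _ => z‖) =O[atTop] fun k => (specRadius J).toReal ^ k := by
  obtain ⟨v, hv⟩ := exists_le_spectralRadius_pow_smul hJ
    (t := fun k => errorVec P Q NA NB z (x k) (y k)) hstep
  refine Asymptotics.IsBigO.of_bound (g * v 0 + v 1) (Eventually.of_forall fun k => ?_)
  have hconsensus : NA (x k - toOp P (x k)) ≤ (specRadius J).toReal ^ k * v 0 := hv k 0
  have hoptimality : ‖toOp P (x k) - stack fun _ => z‖ ≤ (specRadius J).toReal ^ k * v 1 := hv k 1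
  rw [norm_norm, Real.norm_of_nonneg (pow_nonneg ENNReal.toReal_nonneg k)]
  calc ‖x k - stack fun _ => z‖
      ≤ g * NA (x k - toOp P (x k)) + ‖toOp P (x k) - stack fun _ => z‖ := hc.norm_sub_le P _ _
    _ ≤ g * ((specRadius J).toReal ^ k * v 0) + (specRadius J).toReal ^ k * v 1 :=
        add_le_add (mul_le_mul_of_nonneg_left hconsensus hc.g_pos.le) hoptimality
    _ = (g * v 0 + v 1) * (specRadius J).toReal ^ k := by ring

theorem tendsto_and_isBigO_norm_sub_stack {n p : ℕ} {P Q : BigMatrix n p}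
    {NA NB : Seminorm ℝ (StackedVec n p)} {g h l m : ℝ} (hc : IsEquivConsts NA NB g h l m)
    (hJ : ∀ i j, 0 < J i j) (hρ : specRadius J < 1) {z : Vec p} {x y : ℕ → StackedVec n p}
    (hstep : ∀ k, errorVec P Q NA NB z (x (k + 1)) (y (k + 1)) ≤
      J *ᵥ errorVec P Q NA NB z (x k) (y k)) :
    Tendsto (fun k => ‖x k - stack fun _ => z‖) atTop (𝓝 0) ∧
      (fun k => ‖x k - stack fun _ => z‖) =O[atTop] fun k => (specRadius J).toReal ^ k :=
  have hO := isBigO_norm_sub_stack hc hJ hstep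
  ⟨hO.trans_tendsto (tendsto_specRadius_toReal_pow hρ), hO⟩

end Rates

theorem exists_isContractionNorm_isEquivConsts {n p : ℕ} {X Y P Q : BigMatrix n p}
    (hX : Tendsto (fun k : ℕ => X ^ k) atTop (𝓝 P))
    (hY : Tendsto (fun k : ℕ => Y ^ k) atTop (𝓝 Q)) :
    ∃ (NA NB : Seminorm ℝ (StackedVec n p)) (σA σB g h l m : ℝ),
      IsContractionNorm X NA σA ∧ IsContractionNorm Y NB σB ∧ IsEquivConsts NA NB g h l m := by
  obtain ⟨NA, σA, m, hNA, hm, hle_g, hle_m⟩ := exists_isContractionNorm hX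
  obtain ⟨NB, σB, l, hNB, hl, hle_h, hle_l⟩ := exists_isContractionNorm hY
  exact ⟨NA, NB, σA, σB, 1, 1, l, m, hNA, hNB, one_pos, one_pos, hl, hm,
    fun v => (hle_g v).trans_eq (one_mul _).symm, fun v => (hle_h v).trans_eq (one_mul _).symm,
    hle_l, hle_m⟩

end DirOpt

theorem theorem1_general {n p : ℕ} (hn : 0 < n) (G : Digraph (Fin n)) (hG : StronglyConnected G)
    (A B : Matrix (Fin n) (Fin n) ℝ) (hA : IsRowWeights G A) (hB : IsColWeights G B)
    (f : Fin n → Vec p → ℝ) (α β : ℝ) (hf : IsAdmissible f α β) :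
    (∃! πr, IsLeftEigvec A πr) ∧ (∃! πc, IsRightEigvec B πc) ∧ (∃! z, IsOptimal f z) ∧
    Tendsto (fun k : ℕ => kronI p A ^ k) atTop (𝓝 (infPow (kronI p A))) ∧
    Tendsto (fun k : ℕ => kronI p B ^ k) atTop (𝓝 (infPow (kronI p B))) ∧
    (∃ (NA NB : Seminorm ℝ (StackedVec n p)) (σA σB g h l m : ℝ),
      IsContractionNorm (kronI p A) NA σA ∧ IsContractionNorm (kronI p B) NB σB ∧
      IsEquivConsts NA NB g h l m) ∧
    ∀ (πr πc : Fin n → ℝ) (xs : Vec p) (Ainf Binf : BigMatrix n p)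
      (NA NB : Seminorm ℝ (StackedVec n p)) (σA σB g h l m : ℝ)
      (a₁ a₂ a₃ a₄ a₅ a₆ a₇ a₈ a₉ : ℝ) (lam : ℝ → ℝ) (J : ℝ → Matrix (Fin 3) (Fin 3) ℝ),
      IsLeftEigvec A πr → IsRightEigvec B πc → IsOptimal f xs →
      Ainf = infPow (kronI p A) → Binf = infPow (kronI p B) →
      IsContractionNorm (kronI p A) NA σA → IsContractionNorm (kronI p B) NB σB →
      IsEquivConsts NA NB g h l m →
      a₁ = m * g * β * specNorm (1 - Ainf) * specNorm Binf →
      a₂ = m * β * specNorm (1 - Ainf) * specNorm Binf →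
      a₃ = m * h * specNorm (1 - Ainf) →
      a₄ = n * β * g * (πr ⬝ᵥ πc) →
      a₅ = h * specNorm Ainf →
      a₆ = g * σB * l * β * specNorm (kronI p A - 1) →
      a₇ = g * σB * l * β ^ 2 * specNorm Binf →
      a₈ = σB * l * β ^ 2 * specNorm Binf →
      a₉ = h * σB * l * β →
      (∀ η, lam η = max |1 - α * n * η * (πr ⬝ᵥ πc)| |1 - β * n * η * (πr ⬝ᵥ πc)|) →
      (∀ η, J η = errorMatrix σA σB (lam η) η a₁ a₂ a₃ a₄ a₅ a₆ a₇ a₈ a₉) →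
      (2 ≤ n → 1 ≤ p → 0 < a₁ ∧ 0 < a₂ ∧ 0 < a₃ ∧ 0 < a₄ ∧ 0 < a₅ ∧ 0 < a₆ ∧ 0 < a₇ ∧
        0 < a₈ ∧ 0 < a₉) ∧
      (∀ η, 0 < η → ∀ i j, 0 ≤ J η i j) ∧
      (∀ η, 0 < η → ∀ (x₀ : Fin n → Vec p) (k : ℕ),
        errorVec Ainf Binf NA NB xs (xIter A B f η x₀ (k + 1)) (yIter A B f η x₀ (k + 1)) ≤
          J η *ᵥ errorVec Ainf Binf NA NB xs (xIter A B f η x₀ k) (yIter A B f η x₀ k)) ∧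
      (∀ ε₁ ε₂ ε₃ η : ℝ, 0 < ε₁ → 0 < ε₂ → 0 < ε₃ →
        ε₁ < (1 - σB) * ε₃ / a₆ →
        (a₄ * ε₁ + a₅ * ε₃) / (α * n * (πr ⬝ᵥ πc)) < ε₂ →
        0 < η →
        η < min (ε₁ * (1 - σA) / (a₁ * ε₁ + a₂ * ε₂ + a₃ * ε₃))
              (min (((1 - σB) * ε₃ - ε₁ * a₆) / (a₇ * ε₁ + a₈ * ε₂ + a₉ * ε₃))
                (1 / (n * β * (πr ⬝ᵥ πc)))) →
        specRadius (J η) < 1 ∧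
        ∀ x₀ : Fin n → Vec p,
          Tendsto (fun k => ‖xIter A B f η x₀ k - stack (fun _ => xs)‖) atTop (𝓝 0) ∧
          (fun k => ‖xIter A B f η x₀ k - stack (fun _ => xs)‖) =O[atTop]
            fun k => (specRadius (J η)).toReal ^ k) := by
  have : NeZero n := ⟨hn.ne'⟩
  have hleft := hA.existsUnique_isLeftEigvec hG
  have hright := hB.existsUnique_isRightEigvec hG
  obtain ⟨_, hAlim⟩ := hleft.exists.imp fun _ => hA.tendsto_kronI_pow (p := p) hG
  obtain ⟨_, hBlim⟩ := hright.exists.imp fun _ => hB.tendsto_kronI_pow (p := p) hG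
  refine ⟨hleft, hright, hf.existsUnique_isOptimal, tendsto_nhds_limUnder ⟨_, hAlim⟩,
    tendsto_nhds_limUnder ⟨_, hBlim⟩, exists_isContractionNorm_isEquivConsts hAlim hBlim, ?_⟩
  intro πr πc xs Ainf Binf NA NB σA σB g h l m a₁ a₂ a₃ a₄ a₅ a₆ a₇ a₈ a₉ lam J hπr hπc hxs
    hAinf hBinf hNA hNB hc ha₁ ha₂ ha₃ ha₄ ha₅ ha₆ ha₇ ha₈ ha₉ hlam hJ
  have hP := hA.tendsto_kronI_pow (p := p) hG hπr
  have hQ := hB.tendsto_kronI_pow (p := p) hG hπc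
  obtain rfl := hAinf.trans hP.limUnder_eq
  obtain rfl := hBinf.trans hQ.limUnder_eq
  have hr := hπr.dotProduct_pos hA hB hG hπc
  have hpos (hn : 2 ≤ n) (hp : 1 ≤ p) :=
    hc.recursionConsts_pos hn hp hf.beta_pos hNB.sigma_pos hr hπr.ne_zero hπc.ne_zero hP
  have hnonneg (η : ℝ) (hη : 0 < η) (i j : Fin 3) := hc.recursionMatrix_nonneg hf.beta_pos.le
    hr.le hNA.sigma_pos.le hNB.sigma_pos.le
    ((hlam η).symm ▸ le_max_of_le_left (abs_nonneg _) : 0 ≤ lam η) hη.le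
    (kronI p A) (consensusLimit p πr) (trackingLimit p πc) i j
  have hstep (η : ℝ) (hη : 0 < η) := hf.errorVec_succ_le hxs hr.le hP hQ hNA hNB hc hη.le
  simp only [← ha₁, ← ha₂, ← ha₃, ← ha₄, ← ha₅, ← ha₆, ← ha₇, ← ha₈, ← ha₉, ← hlam, ← hJ]
    at hpos hnonneg hstep
  refine ⟨hpos, hnonneg, hstep, fun ε₁ ε₂ ε₃ η hε₁ hε₂ hε₃ hε₁₃ hε₂' hη hlt => ?_⟩
  -- If `A ⊗ I_p = 1`, then `a₆ = 0` and the bound on `ε₁` is the junk value `0`.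
  have hne : kronI p A ≠ 1 := by
    intro h
    rw [ha₆, h, sub_self, specNorm_zero, mul_zero, div_zero] at hε₁₃
    exact hε₁₃.not_gt hε₁
  obtain ⟨hn, hp⟩ := hA.two_le_and_one_le hne
  have : NeZero p := ⟨Nat.ne_zero_of_lt hp⟩
  obtain ⟨hJ_pos, hρ⟩ := errorMatrix_pos_and_specRadius_lt_one hf.alpha_pos hf.alpha_le_beta
    (Nat.cast_pos.2 ‹0 < n›) hr hNA.sigma_pos.le hNB.sigma_pos.le (hpos hn hp) hε₁ hε₂ hε₃ hε₂'
    hη hlt (hlam η ▸ hJ η)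
  exact ⟨hρ, fun x₀ => tendsto_and_isBigO_norm_sub_stack hc hJ_pos hρ (hstep η hη x₀)⟩

theorem theorem1 {n p : ℕ} (hn : 0 < n) (G : Digraph (Fin n)) (hG : StronglyConnected G)
    (A B : Matrix (Fin n) (Fin n) ℝ) (hA : IsRowWeights G A) (hB : IsColWeights G B)
    (f : Fin n → Vec p → ℝ) (α β : ℝ) (hf : IsAdmissible f α β) :
    -- The objects that occur in the result exist.
    (∃! πr, IsLeftEigvec A πr) ∧ (∃! πc, IsRightEigvec B πc) ∧ (∃! z, IsOptimal f z) ∧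
    Tendsto (fun k : ℕ => kronI p A ^ k) atTop (𝓝 (infPow (kronI p A))) ∧
    Tendsto (fun k : ℕ => kronI p B ^ k) atTop (𝓝 (infPow (kronI p B))) ∧
    (∃ (NA NB : Seminorm ℝ (StackedVec n p)) (σA σB g h l m : ℝ),
      IsContractionNorm (kronI p A) NA σA ∧ IsContractionNorm (kronI p B) NB σB ∧
      IsEquivConsts NA NB g h l m) ∧
    -- The result holds for every choice of them.
    ∀ (πr πc : Fin n → ℝ) (xs : Vec p) (Ainf Binf : BigMatrix n p)
      (NA NB : Seminorm ℝ (StackedVec n p)) (σA σB g h l m : ℝ)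
      (a₁ a₂ a₃ a₄ a₅ a₆ a₇ a₈ a₉ : ℝ) (lam : ℝ → ℝ) (J : ℝ → Matrix (Fin 3) (Fin 3) ℝ),
      IsLeftEigvec A πr → IsRightEigvec B πc → IsOptimal f xs →
      Ainf = infPow (kronI p A) → Binf = infPow (kronI p B) →
      IsContractionNorm (kronI p A) NA σA → IsContractionNorm (kronI p B) NB σB →
      IsEquivConsts NA NB g h l m →
      a₁ = m * g * β * specNorm (1 - Ainf) * specNorm Binf →
      a₂ = m * β * specNorm (1 - Ainf) * specNorm Binf →
      a₃ = m * h * specNorm (1 - Ainf) →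
      a₄ = n * β * g * (πr ⬝ᵥ πc) →
      a₅ = h * specNorm Ainf →
      a₆ = g * σB * l * β * specNorm (kronI p A - 1) →
      a₇ = g * σB * l * β ^ 2 * specNorm Binf →
      a₈ = σB * l * β ^ 2 * specNorm Binf →
      a₉ = h * σB * l * β →
      (∀ η, lam η = max |1 - α * n * η * (πr ⬝ᵥ πc)| |1 - β * n * η * (πr ⬝ᵥ πc)|) →
      (∀ η, J η = errorMatrix σA σB (lam η) η a₁ a₂ a₃ a₄ a₅ a₆ a₇ a₈ a₉) →
      -- The constants are positive (outside the degenerate cases) and `J(η)` is nonnegative.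
      (2 ≤ n → 1 ≤ p → 0 < a₁ ∧ 0 < a₂ ∧ 0 < a₃ ∧ 0 < a₄ ∧ 0 < a₅ ∧ 0 < a₆ ∧ 0 < a₇ ∧
        0 < a₈ ∧ 0 < a₉) ∧
      (∀ η, 0 < η → ∀ i j, 0 ≤ J η i j) ∧
      -- The entrywise linear inequality.
      (∀ η, 0 < η → η < 2 / (n * β * (πr ⬝ᵥ πc)) → ∀ (x₀ : Fin n → Vec p) (k : ℕ),
        errorVec Ainf Binf NA NB xs (xIter A B f η x₀ (k + 1)) (yIter A B f η x₀ (k + 1)) ≤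
          J η *ᵥ errorVec Ainf Binf NA NB xs (xIter A B f η x₀ k) (yIter A B f η x₀ k)) ∧
      -- Geometric convergence for small step-sizes.
      (∀ ε₁ ε₂ ε₃ η : ℝ, 0 < ε₁ → 0 < ε₂ → 0 < ε₃ →
        ε₁ < (1 - σB) * ε₃ / a₆ →
        (a₄ * ε₁ + a₅ * ε₃) / (α * n * (πr ⬝ᵥ πc)) < ε₂ →
        0 < η →
        η < min (ε₁ * (1 - σA) / (a₁ * ε₁ + a₂ * ε₂ + a₃ * ε₃))
              (min (((1 - σB) * ε₃ - ε₁ * a₆) / (a₇ * ε₁ + a₈ * ε₂ + a₉ * ε₃))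
                (1 / (n * β * (πr ⬝ᵥ πc)))) →
        specRadius (J η) < 1 ∧
        ∀ x₀ : Fin n → Vec p,
          Tendsto (fun k => ‖xIter A B f η x₀ k - stack (fun _ => xs)‖) atTop (𝓝 0) ∧
          (fun k => ‖xIter A B f η x₀ k - stack (fun _ => xs)‖) =O[atTop]
            fun k => (specRadius (J η)).toReal ^ k) := by
  obtain ⟨hleft, hright, hopt, hA', hB', hN, hrec⟩ := theorem1_general hn G hG A B hA hB f α β hf
  refine ⟨hleft, hright, hopt, hA', hB', hN, ?_⟩
  peel hrec
  exact this.imp_left fun h η hη _ => h η hη
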